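/- **Proposition 2.1.** Let $N\ge 1$ and $\rho_0,\dots,\rho_{N-1}>0$. All spaces are complex. Let $$V=\Big\{\underline u=(u_0,\dots,u_{N-1})\in\prod_{j=0}^{N-1}H^1(j,j+1)\;:\;u_{N-1}(N)=0,\ u_{j-1}(j)=u_j(j),\ 1\le j\le N-1\Big\},$$ with the inner product $\langle \underline u,\underline{\tilde u}\rangle_V=\sum_{j}\int_j^{j+1}\rho_j\,\partial_xu_j\,\overline{\partial_x\tilde u_j}\,dx$, and let $\mathcal H=V\times\prod_{j=0}^{N-1}L^2(j,j+1)$ with the product inner product. Define $\mathcal A(\underline u,\underline v)=(\underline v,(\rho_j\partial_x^2u_j)_{0\le j\le N-1})$ on the domain $\mathcal D(\mathcal A)$ of all $(\underline u,\underline v)\in\mathcal H$ with $u_j\in H^2(j,j+1)$ for all $j$, $\underline v\in V$, $\rho_0\partial_xu_0(0)=v_0(0)$ and $-\rho_j\partial_xu_j(j)+\rho_{j-1}\partial_xu_{j-1}(j)=0$ for $1\le j\le N-1$. Then: (i) $\mathcal H$ is a Hilbert space, and $\mathcal A$ is the infinitesimal generator of a strongly continuous semigroup of contractions on $\mathcal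 H$. For every $U_0\in\mathcal H$ there is a unique solution $U\in C([0,\infty),\mathcal H)$ of $U'=\mathcal AU$, $U(0)=U_0$, in the mild sense that $\int_0^tU(s)\,ds\in\mathcal D(\mathcal A)$ and $U(t)=U_0+\mathcal A\int_0^tU(s)\,ds$ for all $t\ge0$. If $U_0\in\mathcal D(\mathcal A)$, then $U\in C([0,\infty),\mathcal D(\mathcal A))\cap C^1([0,\infty),\mathcal H)$ (where $\mathcal D(\mathcal A)$ carries the graph norm), and $U'(t)=\mathcal AU(t)$ for all $t\ge0$. (ii) Let $U=(\underline u,\underline v)\in C([0,\infty),\mathcal D(\mathcal A))\cap C^1([0,\infty),\mathcal H)$ satisfy $U'=\mathcal AU$ on $[0,\infty)$ (so $\underline v=\partial_t\underline u$); by (i), this covers the solution for any $U_0\in\mathcal D(\mathcal A)$. Then $t\mapsto u_0(t,0)$ is differentiable on $[0,\infty)$ with derivative $\partial_tu_0(t,0)=v_0(t,0)$, and the energy $$E(t)=\frac12\sum_{j=0}^{N-1}\int_j^{j+1}\big(|\partial_tu_j(t,x)|^2+\rho_j|\partial_xu_j(t,x)|^2\big)\,dx$$ is differentiable on $[0,\infty)$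 with $E'(t)=-|\partial_tu_0(t,0)|^2\le 0$ for all $t\ge0$ (derivatives at $t=0$ are one-sided). In particular, $E$ is nonincreasing. -/

import Mathlib

open MeasureTheory Set Filter Topology
open scoped ContDiff InnerProductSpace

noncomputable section

/-- A chain of `N ≥ 1` strings `(j, j + 1)`, `j = 0, …, N - 1`, with densities `ρ_j > 0`. -/
structure StringChain where
  N : ℕ
  N_pos : 0 < N
  ρ : Fin N → ℝ
  ρ_pos : ∀ j, 0 < ρ j

namespace StringChain

/-! ### Sobolev spaces on a bounded open interval -/

/-- The complex Hilbert space `L²(a, b)`. -/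
abbrev L2 (a b : ℝ) : Type := Lp ℂ 2 (volume.restrict (Ioo a b))

/-- Test functions on `(a, b)`: smooth, with compact support contained in `(a, b)`. -/
structure IsTestFunction (a b : ℝ) (φ : ℝ → ℝ) : Prop where
  contDiff : ContDiff ℝ ∞ φ
  hasCompactSupport : HasCompactSupport φ
  tsupport_subset : tsupport φ ⊆ Ioo a b

/-- `g ∈ L²(a, b)` is the weak derivative of `u ∈ L²(a, b)`. -/
def HasWeakDeriv {a b : ℝ} (u g : L2 a b) : Prop :=
  ∀ φ : ℝ → ℝ, IsTestFunction a b φ →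
    ∫ x in Ioo a b, deriv φ x • u x = - ∫ x in Ioo a b, φ x • g x

/-- `u ∈ H¹(a, b)`. -/
def MemH1 {a b : ℝ} (u : L2 a b) : Prop := ∃ g : L2 a b, HasWeakDeriv u g

open Classical in
/-- The weak derivative `∂ₓ u` of `u ∈ H¹(a, b)` (and `0` when `u ∉ H¹(a, b)`). -/
def weakDeriv {a b : ℝ} (u : L2 a b) : L2 a b :=
  if h : MemH1 u then h.choose else 0

/-- `u ∈ H²(a, b)`. -/
def MemH2 {a b : ℝ} (u : L2 a b) : Prop := MemH1 u ∧ MemH1 (weakDeriv u)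

/-- The continuous representative of `u ∈ L²(a, b)` on the closed interval `[a, b]` exists and takes
the value `c` at `x`. -/
def HasValueAt {a b : ℝ} (u : L2 a b) (x : ℝ) (c : ℂ) : Prop :=
  ∃ f : ℝ → ℂ, ContinuousOn f (Icc a b) ∧ u =ᵐ[volume.restrict (Ioo a b)] f ∧ f x = c

section Interval

variable {a b : ℝ}

theorem IsTestFunction.deriv {φ : ℝ → ℝ} (h : IsTestFunction a b φ) :
    IsTestFunction a b (deriv φ) where
  contDiff := ((contDiff_infty_iff_deriv (𝕜 := ℝ)).1 h.contDiff).2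
  hasCompactSupport := h.hasCompactSupport.deriv
  tsupport_subset := (closure_minimal support_deriv_subset
    (isClosed_tsupport φ)).trans h.tsupport_subset

theorem L2.integrable (u : L2 a b) : Integrable u (volume.restrict (Ioo a b)) :=
  (Lp.memLp u).integrable (by norm_num)

theorem IsTestFunction.integrable_smul {φ : ℝ → ℝ} (h : IsTestFunction a b φ) (u : L2 a b) :
    Integrable (fun x => φ x • u x) (volume.restrict (Ioo a b)) := by
  obtain ⟨C, hC⟩ := h.hasCompactSupport.exists_bound_of_continuous h.contDiff.continuous
  exact (L2.integrable u).bdd_smul C h.contDiff.continuous.aestronglyMeasurable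
    (Eventually.of_forall hC)

theorem HasWeakDeriv.add {u g v k : L2 a b} (hu : HasWeakDeriv u g) (hv : HasWeakDeriv v k) :
    HasWeakDeriv (u + v) (g + k) := by
  intro φ hφ
  have h1 : ∫ x in Ioo a b, deriv φ x • (u + v) x
      = ∫ x in Ioo a b, (deriv φ x • u x + deriv φ x • v x) := by
    refine integral_congr_ae ?_
    filter_upwards [Lp.coeFn_add u v] with x hx
    rw [hx, Pi.add_apply, smul_add]
  have h2 : ∫ x in Ioo a b, φ x • (g + k) x
      = ∫ x in Ioo a b, (φ x • g x + φ x • k x) := by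
    refine integral_congr_ae ?_
    filter_upwards [Lp.coeFn_add g k] with x hx
    rw [hx, Pi.add_apply, smul_add]
  rw [h1, h2, integral_add (hφ.deriv.integrable_smul u) (hφ.deriv.integrable_smul v),
    integral_add (hφ.integrable_smul g) (hφ.integrable_smul k), hu φ hφ, hv φ hφ, neg_add]

theorem HasWeakDeriv.smul {u g : L2 a b} (c : ℂ) (hu : HasWeakDeriv u g) :
    HasWeakDeriv (c • u) (c • g) := by
  intro φ hφ
  have h1 : ∫ x in Ioo a b, deriv φ x • (c • u) x
      = ∫ x in Ioo a b, c • (deriv φ x • u x) := by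
    refine integral_congr_ae ?_
    filter_upwards [Lp.coeFn_smul c u] with x hx
    rw [hx, Pi.smul_apply, smul_comm]
  have h2 : ∫ x in Ioo a b, φ x • (c • g) x
      = ∫ x in Ioo a b, c • (φ x • g x) := by
    refine integral_congr_ae ?_
    filter_upwards [Lp.coeFn_smul c g] with x hx
    rw [hx, Pi.smul_apply, smul_comm]
  rw [h1, h2, integral_smul, integral_smul, hu φ hφ, smul_neg]

theorem hasWeakDeriv_zero : HasWeakDeriv (0 : L2 a b) 0 := by
  intro φ _
  have h (ψ : ℝ → ℝ) : ∫ x in Ioo a b, ψ x • (0 : L2 a b) x = 0 := by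
    rw [← integral_zero ℝ ℂ (μ := volume.restrict (Ioo a b))]
    refine integral_congr_ae ?_
    filter_upwards [Lp.coeFn_zero ℂ 2 (volume.restrict (Ioo a b))] with x hx
    rw [hx, Pi.zero_apply, smul_zero]
  rw [h, h, neg_zero]

theorem ae_eq_zero_of_forall_test {f : ℝ → ℂ} (hf : IntegrableOn f (Ioo a b))
    (h : ∀ φ : ℝ → ℝ, IsTestFunction a b φ → ∫ x in Ioo a b, φ x • f x = 0) :
    f =ᵐ[volume.restrict (Ioo a b)] 0 := by
  rw [Filter.EventuallyEq, ae_restrict_iff' measurableSet_Ioo]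
  refine isOpen_Ioo.ae_eq_zero_of_integral_contDiff_smul_eq_zero hf.locallyIntegrableOn ?_
  intro φ h1 h2 h3
  rw [← h φ ⟨h1, h2, h3⟩]
  refine (setIntegral_eq_integral_of_forall_compl_eq_zero fun x hx => ?_).symm
  rw [image_eq_zero_of_notMem_tsupport fun hx' => hx (h3 hx'), zero_smul]

theorem HasWeakDeriv.unique {u g k : L2 a b} (hg : HasWeakDeriv u g) (hk : HasWeakDeriv u k) :
    g = k := by
  have h : (fun x => g x - k x) =ᵐ[volume.restrict (Ioo a b)] 0 := by
    refine ae_eq_zero_of_forall_test ((L2.integrable g).sub (L2.integrable k)) fun φ hφ => ?_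
    simp_rw [smul_sub]
    rw [integral_sub (hφ.integrable_smul g) (hφ.integrable_smul k), sub_eq_zero, ← neg_inj,
      ← hg φ hφ, hk φ hφ]
  refine Lp.ext ?_
  filter_upwards [h] with x hx
  exact sub_eq_zero.1 hx

theorem MemH1.hasWeakDeriv {u : L2 a b} (h : MemH1 u) : HasWeakDeriv u (weakDeriv u) := by
  rw [weakDeriv, dif_pos h]
  exact h.choose_spec

theorem HasWeakDeriv.weakDeriv_eq {u g : L2 a b} (h : HasWeakDeriv u g) : weakDeriv u = g :=
  HasWeakDeriv.unique (MemH1.hasWeakDeriv ⟨g, h⟩) h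

theorem MemH1.add {u v : L2 a b} (hu : MemH1 u) (hv : MemH1 v) : MemH1 (u + v) :=
  ⟨_, hu.hasWeakDeriv.add hv.hasWeakDeriv⟩

theorem MemH1.smul {u : L2 a b} (c : ℂ) (hu : MemH1 u) : MemH1 (c • u) :=
  ⟨_, hu.hasWeakDeriv.smul c⟩

theorem memH1_zero : MemH1 (0 : L2 a b) := ⟨0, hasWeakDeriv_zero⟩

theorem weakDeriv_zero : weakDeriv (0 : L2 a b) = 0 := hasWeakDeriv_zero.weakDeriv_eq

theorem MemH1.weakDeriv_add {u v : L2 a b} (hu : MemH1 u) (hv : MemH1 v) :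
    weakDeriv (u + v) = weakDeriv u + weakDeriv v :=
  (hu.hasWeakDeriv.add hv.hasWeakDeriv).weakDeriv_eq

theorem MemH1.weakDeriv_smul {u : L2 a b} (c : ℂ) (hu : MemH1 u) :
    weakDeriv (c • u) = c • weakDeriv u :=
  (hu.hasWeakDeriv.smul c).weakDeriv_eq

theorem MemH2.add {u v : L2 a b} (hu : MemH2 u) (hv : MemH2 v) : MemH2 (u + v) :=
  ⟨hu.1.add hv.1, by rw [hu.1.weakDeriv_add hv.1]; exact hu.2.add hv.2⟩

theorem MemH2.smul {u : L2 a b} (c : ℂ) (hu : MemH2 u) : MemH2 (c • u) :=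
  ⟨hu.1.smul c, by rw [hu.1.weakDeriv_smul]; exact hu.2.smul c⟩

theorem memH2_zero : MemH2 (0 : L2 a b) :=
  ⟨memH1_zero, by rw [weakDeriv_zero]; exact memH1_zero⟩

theorem HasValueAt.add {u v : L2 a b} {x : ℝ} {c d : ℂ} (hu : HasValueAt u x c)
    (hv : HasValueAt v x d) : HasValueAt (u + v) x (c + d) := by
  obtain ⟨f, hf, huf, rfl⟩ := hu
  obtain ⟨g, hg, hvg, rfl⟩ := hv
  refine ⟨f + g, hf.add hg, ?_, rfl⟩
  filter_upwards [Lp.coeFn_add u v, huf, hvg] with x h1 h2 h3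
  rw [h1, Pi.add_apply, Pi.add_apply, h2, h3]

theorem HasValueAt.smul {u : L2 a b} {x : ℝ} {c : ℂ} (r : ℂ) (hu : HasValueAt u x c) :
    HasValueAt (r • u) x (r * c) := by
  obtain ⟨f, hf, huf, rfl⟩ := hu
  refine ⟨fun y => r * f y, continuousOn_const.mul hf, ?_, rfl⟩
  filter_upwards [Lp.coeFn_smul r u, huf] with x h1 h2
  rw [h1, Pi.smul_apply, h2, smul_eq_mul]

theorem hasValueAt_zero (x : ℝ) : HasValueAt (0 : L2 a b) x 0 :=
  ⟨0, continuousOn_const, Lp.coeFn_zero _ _ _, rfl⟩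

theorem HasValueAt.unique {u : L2 a b} {x : ℝ} {c d : ℂ} (hab : a < b) (hx : x ∈ Icc a b)
    (hc : HasValueAt u x c) (hd : HasValueAt u x d) : c = d := by
  obtain ⟨f, hf, huf, rfl⟩ := hc
  obtain ⟨g, hg, hug, rfl⟩ := hd
  have h : f =ᵐ[volume.restrict (Icc a b)] g := by
    rw [← restrict_Ioo_eq_restrict_Icc]
    exact huf.symm.trans hug
  exact Measure.eqOn_Icc_of_ae_eq volume hab.ne h hf hg hx

theorem exists_primitive {ψ : ℝ → ℝ} (hψ : IsTestFunction a b ψ) (h0 : ∫ x, ψ x = 0) :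
    ∃ φ : ℝ → ℝ, IsTestFunction a b φ ∧ deriv φ = ψ := by
  have hcont := hψ.contDiff.continuous
  set φ : ℝ → ℝ := fun x => ∫ y in a..x, ψ y with hφ
  have hd : ∀ x, HasDerivAt φ (ψ x) x := fun x =>
    intervalIntegral.integral_hasDerivAt_right (hcont.intervalIntegrable _ _)
      (hcont.stronglyMeasurableAtFilter _ _) hcont.continuousAt
  have hderiv : deriv φ = ψ := funext fun x => (hd x).deriv
  have hK : IsCompact (tsupport ψ) := hψ.hasCompactSupport
  obtain ⟨m, M, ham, hMb, hsub⟩ : ∃ m M, a < m ∧ M < b ∧ tsupport ψ ⊆ Icc m M := by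
    rcases (tsupport ψ).eq_empty_or_nonempty with he | hne
    · exact ⟨a + 1, b - 1, by linarith, by linarith, by simp [he]⟩
    · exact ⟨sInf (tsupport ψ), sSup (tsupport ψ),
        (hψ.tsupport_subset (hK.sInf_mem hne)).1, (hψ.tsupport_subset (hK.sSup_mem hne)).2,
        fun x hx => ⟨csInf_le hK.bddBelow hx, le_csSup hK.bddAbove hx⟩⟩
  have hz : ∀ x, x ∉ Icc m M → ψ x = 0 := fun x hx =>
    image_eq_zero_of_notMem_tsupport fun h => hx (hsub h)
  have hsupp : Function.support φ ⊆ Icc m M := by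
    intro x hx
    by_contra hxn
    apply hx
    rcases lt_or_ge x m with hxm | hxm
    · have : ∀ y ∈ uIcc a x, ψ y = 0 := by
        intro y hy
        refine hz y fun h => ?_
        have h2 : y ≤ max a x := hy.2
        exact absurd (h.1.trans h2) (not_le.2 (max_lt ham hxm))
      calc φ x = ∫ y in a..x, (0 : ℝ) := intervalIntegral.integral_congr this
        _ = 0 := by simp
    · have hMx : M < x := by
        by_contra hc
        exact hxn ⟨hxm, not_lt.1 hc⟩
      rw [← h0]
      refine intervalIntegral.integral_eq_integral_of_support_subset ?_
      intro y hy
      have := hsub (subset_tsupport ψ hy)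
      exact ⟨ham.trans_le this.1, this.2.trans hMx.le⟩
  have hts : tsupport φ ⊆ Icc m M := closure_minimal hsupp isClosed_Icc
  refine ⟨φ, ⟨?_, ?_, ?_⟩, hderiv⟩
  · rw [contDiff_infty_iff_deriv, hderiv]
    exact ⟨fun x => (hd x).differentiableAt, hψ.contDiff⟩
  · exact isCompact_Icc.of_isClosed_subset (isClosed_tsupport φ) hts
  · exact hts.trans fun x hx => ⟨ham.trans_le hx.1, hx.2.trans_lt hMb⟩

theorem exists_const_of_hasWeakDeriv_zero (hab : a < b) {u : L2 a b} (h : HasWeakDeriv u 0) :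
    ∃ c : ℂ, u =ᵐ[volume.restrict (Ioo a b)] fun _ => c := by
  obtain ⟨ψ₀, hψ₀, hint⟩ : ∃ ψ₀ : ℝ → ℝ, IsTestFunction a b ψ₀ ∧ ∫ x, ψ₀ x = 1 := by
    let B : ContDiffBump ((a + b) / 2) :=
      ⟨(b - a) / 8, (b - a) / 4, by linarith, by linarith⟩
    refine ⟨B.normed volume, ⟨B.contDiff_normed, B.hasCompactSupport_normed, ?_⟩,
      B.integral_normed⟩
    rw [B.tsupport_normed_eq, Real.closedBall_eq_Icc]
    intro x hx
    have h1 := hx.1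
    have h2 := hx.2
    simp only [B] at h1 h2
    exact ⟨by linarith, by linarith⟩
  have hfull : ∀ φ : ℝ → ℝ, IsTestFunction a b φ → ∫ x in Ioo a b, φ x = ∫ x, φ x :=
    fun φ hφ => setIntegral_eq_integral_of_forall_compl_eq_zero fun x hx =>
      image_eq_zero_of_notMem_tsupport fun hx' => hx (hφ.tsupport_subset hx')
  have hI : ∀ φ : ℝ → ℝ, IsTestFunction a b φ → Integrable φ volume := fun φ hφ =>
    hφ.contDiff.continuous.integrable_of_hasCompactSupport hφ.hasCompactSupport
  have hzero : ∀ φ : ℝ → ℝ, IsTestFunction a b φ → ∫ x in Ioo a b, deriv φ x • u x = 0 := by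
    intro φ hφ
    rw [h φ hφ, neg_eq_zero, ← integral_zero ℝ ℂ (μ := volume.restrict (Ioo a b))]
    refine integral_congr_ae ?_
    filter_upwards [Lp.coeFn_zero ℂ 2 (volume.restrict (Ioo a b))] with x hx
    rw [hx, Pi.zero_apply, smul_zero]
  set c : ℂ := ∫ x in Ioo a b, ψ₀ x • u x with hc
  refine ⟨c, ?_⟩
  have key : (fun x => u x - c) =ᵐ[volume.restrict (Ioo a b)] 0 := by
    refine ae_eq_zero_of_forall_test ((L2.integrable u).sub (integrable_const c)) fun ψ hψ => ?_
    set s : ℝ := ∫ x, ψ x with hs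
    have htest : IsTestFunction a b (fun x => ψ x - s * ψ₀ x) := by
      refine ⟨hψ.contDiff.sub (contDiff_const.mul hψ₀.contDiff),
        hψ.hasCompactSupport.sub hψ₀.hasCompactSupport.mul_left, ?_⟩
      have h1 : Function.support (fun x => ψ x - s * ψ₀ x) ⊆ tsupport ψ ∪ tsupport ψ₀ := by
        intro x hx
        by_contra hn
        rw [mem_union, not_or] at hn
        apply hx
        simp [image_eq_zero_of_notMem_tsupport hn.1, image_eq_zero_of_notMem_tsupport hn.2]
      exact (closure_minimal h1 ((isClosed_tsupport _).union (isClosed_tsupport _))).trans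
        (union_subset hψ.tsupport_subset hψ₀.tsupport_subset)
    obtain ⟨φ, hφ, hdφ⟩ := exists_primitive htest (by
      rw [integral_sub (hI ψ hψ) ((hI ψ₀ hψ₀).const_mul s), integral_const_mul, hint]
      simp [hs])
    have h2 := hzero φ hφ
    rw [hdφ] at h2
    have h3 : ∫ x in Ioo a b, ψ x • u x = s • c := by
      have h4 : ∀ x, (ψ x - s * ψ₀ x) • u x = ψ x • u x - s • (ψ₀ x • u x) := fun x => by
        rw [sub_smul, mul_smul]
      simp_rw [h4] at h2
      have h6 : Integrable (fun x => s • (ψ₀ x • u x)) (volume.restrict (Ioo a b)) :=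
        (hψ₀.integrable_smul u).smul s
      rw [integral_sub (hψ.integrable_smul u) h6, integral_smul, sub_eq_zero] at h2
      exact h2
    have h5 : ∫ x in Ioo a b, ψ x • c = s • c := by
      rw [integral_smul_const, hfull ψ hψ]
    simp_rw [smul_sub]
    rw [integral_sub (hψ.integrable_smul u) ((hI ψ hψ).integrableOn.smul_const c), h3, h5,
      sub_self]
  filter_upwards [key] with x hx
  exact sub_eq_zero.1 hx

end Interval

/-! ### The energy space of the chain -/

section EnergySpace

variable (S : StringChain)

/-- The first string, with index `0`. -/
def first : Fin S.N := ⟨0, S.N_pos⟩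

/-- The last string, with index `N - 1`. -/
def last : Fin S.N := ⟨S.N - 1, Nat.sub_lt S.N_pos one_pos⟩

/-- The Hilbert space `∏_j L²(j, j + 1)`. -/
abbrev L2Prod : Type :=
  PiLp 2 fun j : Fin S.N => L2 ((j : ℕ) : ℝ) (((j : ℕ) : ℝ) + 1)

/-- Membership in `V`: `u_j ∈ H¹(j, j + 1)`, `u_{N-1}(N) = 0`, and `u_{j-1}(j) = u_j(j)` at the
interior nodes (here `i = j - 1`). -/
structure MemV (u : S.L2Prod) : Prop where
  memH1 : ∀ j, MemH1 (u j)
  right_end : HasValueAt (u S.last) (S.N : ℝ) 0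
  node : ∀ i j : Fin S.N, (i : ℕ) + 1 = j →
    ∃ c : ℂ, HasValueAt (u i) ((j : ℕ) : ℝ) c ∧ HasValueAt (u j) ((j : ℕ) : ℝ) c

/-- `V` as a set of elements of `∏_j L²(j, j + 1)`. -/
def submoduleV : Submodule ℂ S.L2Prod where
  carrier := {u | S.MemV u}
  add_mem' := by
    intro u v hu hv
    refine ⟨fun j => (hu.memH1 j).add (hv.memH1 j), ?_, fun i j hij => ?_⟩
    · have h := hu.right_end.add hv.right_end
      rwa [add_zero] at h
    · obtain ⟨c, h1, h2⟩ := hu.node i j hij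
      obtain ⟨d, h3, h4⟩ := hv.node i j hij
      exact ⟨c + d, h1.add h3, h2.add h4⟩
  zero_mem' := ⟨fun _ => memH1_zero, hasValueAt_zero _,
    fun _ _ _ => ⟨0, hasValueAt_zero _, hasValueAt_zero _⟩⟩
  smul_mem' := by
    intro r u hu
    refine ⟨fun j => (hu.memH1 j).smul r, ?_, fun i j hij => ?_⟩
    · have h := hu.right_end.smul r
      rwa [mul_zero] at h
    · obtain ⟨c, h1, h2⟩ := hu.node i j hij
      exact ⟨r * c, h1.smul r, h2.smul r⟩

/-- The space `V`. It is a type of its own, because its norm is not the `L²` norm. -/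
def V : Type := S.submoduleV

instance : AddCommGroup S.V := inferInstanceAs (AddCommGroup S.submoduleV)

instance : Module ℂ S.V := inferInstanceAs (Module ℂ S.submoduleV)

variable {S}

/-- The inclusion `V ⊆ ∏_j L²(j, j + 1)`. -/
def V.toL2 (u : S.V) : S.L2Prod := u.1

theorem V.memV (u : S.V) : S.MemV u.toL2 := u.2

theorem V.toL2_add (u v : S.V) : (u + v).toL2 = u.toL2 + v.toL2 := rfl

theorem V.toL2_smul (c : ℂ) (u : S.V) : (c • u).toL2 = c • u.toL2 := rfl

/-- The `j`-th component `∂ₓ u_j` of the derivative of `u ∈ V`. -/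
def V.dx (u : S.V) (j : Fin S.N) : L2 ((j : ℕ) : ℝ) (((j : ℕ) : ℝ) + 1) := weakDeriv (u.toL2 j)

theorem V.dx_add (u v : S.V) (j : Fin S.N) : (u + v).dx j = u.dx j + v.dx j :=
  (u.memV.memH1 j).weakDeriv_add (v.memV.memH1 j)

theorem V.dx_smul (c : ℂ) (u : S.V) (j : Fin S.N) : (c • u).dx j = c • u.dx j :=
  (u.memV.memH1 j).weakDeriv_smul c

theorem V.eq_zero_of_dx_eq_zero (u : S.V) (h : ∀ j, u.dx j = 0) : u = 0 := by
  have hlt : ∀ j : Fin S.N, ((j : ℕ) : ℝ) < ((j : ℕ) : ℝ) + 1 := fun j => by linarith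
  have hconst : ∀ j : Fin S.N, ∃ c : ℂ, u.toL2 j
      =ᵐ[volume.restrict (Ioo ((j : ℕ) : ℝ) (((j : ℕ) : ℝ) + 1))] fun _ => c := fun j => by
    refine exists_const_of_hasWeakDeriv_zero (hlt j) ?_
    have h1 := (u.memV.memH1 j).hasWeakDeriv
    rwa [show weakDeriv (u.toL2 j) = 0 from h j] at h1
  choose c hc using hconst
  have hval : ∀ (j : Fin S.N) (x : ℝ), HasValueAt (u.toL2 j) x (c j) := fun j x =>
    ⟨fun _ => c j, continuousOn_const, hc j, rfl⟩
  have hzero : ∀ (k : ℕ) (j : Fin S.N), (j : ℕ) + 1 + k = S.N → c j = 0 := by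
    intro k
    induction k with
    | zero =>
      intro j hj
      have hjl : j = S.last := Fin.ext (by simp only [last]; omega)
      subst hjl
      refine (hval _ (S.N : ℝ)).unique (hlt _) ?_ u.memV.right_end
      have h2 : (((S.last : Fin S.N) : ℕ) : ℝ) + 1 = (S.N : ℝ) := by exact_mod_cast hj
      exact ⟨by linarith, by linarith⟩
    | succ k ih =>
      intro i hi
      let j : Fin S.N := ⟨i + 1, by omega⟩
      obtain ⟨d, h1, h2⟩ := u.memV.node i j rfl
      have hj : ((j : ℕ) : ℝ) = ((i : ℕ) : ℝ) + 1 := by simp [j]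
      have h3 : c i = d :=
        (hval i _).unique (hlt i) ⟨by linarith, by linarith⟩ h1
      have h4 : c j = d :=
        (hval j _).unique (hlt j) ⟨by linarith, by linarith⟩ h2
      rw [h3, ← h4]
      exact ih j (by simp only [j]; omega)
  have h0 : u.toL2 = 0 := by
    ext1 j
    refine Lp.ext ?_
    have hcj : c j = 0 := hzero (S.N - (j + 1)) j (by omega)
    filter_upwards [hc j, Lp.coeFn_zero ℂ 2
      (volume.restrict (Ioo ((j : ℕ) : ℝ) (((j : ℕ) : ℝ) + 1)))] with x h1 h2
    rw [h1, hcj]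
    exact h2.symm
  exact Subtype.ext h0

/-- The inner product `⟨u, w⟩_V = ∑_j ∫ ρ_j ∂ₓu_j ∂ₓw_j` (one factor conjugated) of `V`. In Mathlib
the first argument of a complex inner product is the conjugate-linear one. -/
instance : InnerProductSpace.Core ℂ S.V where
  inner u w := ∑ j, (S.ρ j : ℂ) * ⟪u.dx j, w.dx j⟫_ℂ
  conj_inner_symm u w := by
    rw [map_sum]
    refine Finset.sum_congr rfl fun j _ => ?_
    rw [map_mul, Complex.conj_ofReal, inner_conj_symm]
  re_inner_nonneg u := by
    rw [map_sum]
    refine Finset.sum_nonneg fun j _ => ?_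
    rw [RCLike.re_to_complex, Complex.re_ofReal_mul]
    exact mul_nonneg (S.ρ_pos j).le (inner_self_nonneg (𝕜 := ℂ) (x := u.dx j))
  add_left u v w := by
    rw [← Finset.sum_add_distrib]
    refine Finset.sum_congr rfl fun j _ => ?_
    rw [V.dx_add, inner_add_left, mul_add]
  smul_left u w r := by
    rw [Finset.mul_sum]
    refine Finset.sum_congr rfl fun j _ => ?_
    rw [V.dx_smul, inner_smul_left, mul_left_comm]
  definite u hu := by
    refine u.eq_zero_of_dx_eq_zero fun j => ?_
    have h1 : ∑ j, S.ρ j * ‖u.dx j‖ ^ 2 = 0 := by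
      have h2 : ((∑ j, S.ρ j * ‖u.dx j‖ ^ 2 : ℝ) : ℂ) = 0 := by
        rw [← hu]
        push_cast
        refine Finset.sum_congr rfl fun j _ => ?_
        rw [inner_self_eq_norm_sq_to_K]
        rfl
      exact_mod_cast h2
    have h3 := (Finset.sum_eq_zero_iff_of_nonneg fun j _ =>
      mul_nonneg (S.ρ_pos j).le (sq_nonneg ‖u.dx j‖)).1 h1 j (Finset.mem_univ j)
    simpa [(S.ρ_pos j).ne'] using h3

instance : NormedAddCommGroup S.V :=
  InnerProductSpace.Core.toNormedAddCommGroup (𝕜 := ℂ) (F := S.V)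

instance : InnerProductSpace ℂ S.V := InnerProductSpace.ofCore (𝕜 := ℂ) (F := S.V) inferInstance

variable (S)

/-- The energy space `𝓗 = V × ∏_j L²(j, j + 1)` with its product inner product. An element is a
pair `U = (u, v)` with `u = U.fst` and `v = U.snd`. -/
abbrev EnergySpace : Type := WithLp 2 (S.V × S.L2Prod)

/-! ### The operator of the damped chain -/

/-- The domain of the operator: `u_j ∈ H²(j, j + 1)`, `v ∈ V`, `ρ_0 ∂ₓu_0(0) = v_0(0)` and
`-ρ_j ∂ₓu_j(j) + ρ_{j-1} ∂ₓu_{j-1}(j) = 0` at the interior nodes (here `i = j - 1`). -/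
structure MemDomain (U : S.EnergySpace) : Prop where
  memH2 : ∀ j, MemH2 (U.fst.toL2 j)
  memV : S.MemV U.snd
  damping : ∃ c : ℂ, HasValueAt (U.fst.dx S.first) 0 c ∧
    HasValueAt (U.snd S.first) 0 ((S.ρ S.first : ℂ) * c)
  node : ∀ i j : Fin S.N, (i : ℕ) + 1 = j → ∃ c d : ℂ,
    HasValueAt (U.fst.dx i) ((j : ℕ) : ℝ) c ∧ HasValueAt (U.fst.dx j) ((j : ℕ) : ℝ) d ∧
      -(S.ρ j : ℂ) * d + (S.ρ i : ℂ) * c = 0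

theorem dx_fst_add (U W : S.EnergySpace) (j : Fin S.N) :
    (U + W).fst.dx j = U.fst.dx j + W.fst.dx j := V.dx_add _ _ j

theorem dx_fst_smul (r : ℂ) (U : S.EnergySpace) (j : Fin S.N) :
    (r • U).fst.dx j = r • U.fst.dx j := V.dx_smul _ _ j

theorem dx_fst_zero (j : Fin S.N) : (0 : S.EnergySpace).fst.dx j = 0 := weakDeriv_zero

/-- The domain `𝓓(𝓐)`, a linear subspace of the energy space. -/
def domain : Submodule ℂ S.EnergySpace where
  carrier := {U | S.MemDomain U}
  add_mem' := by
    intro U W hU hW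
    refine ⟨fun j => (hU.memH2 j).add (hW.memH2 j),
      S.submoduleV.add_mem hU.memV hW.memV, ?_, fun i j hij => ?_⟩
    · obtain ⟨c, h1, h2⟩ := hU.damping
      obtain ⟨d, h3, h4⟩ := hW.damping
      refine ⟨c + d, ?_, ?_⟩
      · rw [dx_fst_add]
        exact h1.add h3
      · rw [mul_add]
        exact h2.add h4
    · obtain ⟨c, d, h1, h2, h3⟩ := hU.node i j hij
      obtain ⟨c', d', h1', h2', h3'⟩ := hW.node i j hij
      refine ⟨c + c', d + d', ?_, ?_, ?_⟩
      · rw [dx_fst_add]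
        exact h1.add h1'
      · rw [dx_fst_add]
        exact h2.add h2'
      · linear_combination h3 + h3'
  zero_mem' := by
    refine ⟨fun _ => memH2_zero, S.submoduleV.zero_mem, ⟨0, ?_, ?_⟩,
      fun i j _ => ⟨0, 0, ?_, ?_, by simp⟩⟩
    · rw [dx_fst_zero]
      exact hasValueAt_zero _
    · rw [mul_zero]
      exact hasValueAt_zero _
    · rw [dx_fst_zero]
      exact hasValueAt_zero _
    · rw [dx_fst_zero]
      exact hasValueAt_zero _
  smul_mem' := by
    intro r U hU
    refine ⟨fun j => (hU.memH2 j).smul r,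
      S.submoduleV.smul_mem r hU.memV, ?_, fun i j hij => ?_⟩
    · obtain ⟨c, h1, h2⟩ := hU.damping
      refine ⟨r * c, ?_, ?_⟩
      · rw [dx_fst_smul]
        exact h1.smul r
      · rw [mul_left_comm]
        exact h2.smul r
    · obtain ⟨c, d, h1, h2, h3⟩ := hU.node i j hij
      refine ⟨r * c, r * d, ?_, ?_, ?_⟩
      · rw [dx_fst_smul]
        exact h1.smul r
      · rw [dx_fst_smul]
        exact h2.smul r
      · linear_combination r * h3

/-- The component `(u, v) ↦ v` of the operator, with values in `V`. -/
def operatorFst : S.domain →ₗ[ℂ] S.V where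
  toFun U := (⟨U.1.snd, U.2.memV⟩ : S.submoduleV)
  map_add' _ _ := rfl
  map_smul' _ _ := rfl

/-- The component `(u, v) ↦ (ρ_j ∂ₓ²u_j)_j` of the operator, with values in `∏_j L²(j, j + 1)`. -/
def operatorSnd : S.domain →ₗ[ℂ] S.L2Prod where
  toFun U := WithLp.toLp 2 fun j => (S.ρ j : ℂ) • weakDeriv (U.1.fst.dx j)
  map_add' U W := by
    ext1 j
    rw [PiLp.add_apply]
    simp only [Submodule.coe_add, dx_fst_add]
    rw [← smul_add]
    exact congrArg _ ((U.2.memH2 j).2.weakDeriv_add (W.2.memH2 j).2)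
  map_smul' r U := by
    ext1 j
    rw [PiLp.smul_apply]
    simp only [Submodule.coe_smul, dx_fst_smul, RingHom.id_apply]
    rw [smul_comm]
    exact congrArg _ ((U.2.memH2 j).2.weakDeriv_smul r)

/-- The operator `𝓐 (u, v) = (v, (ρ_j ∂ₓ²u_j)_j)` on its domain. -/
def operator : S.EnergySpace →ₗ.[ℂ] S.EnergySpace where
  domain := S.domain
  toFun := (WithLp.linearEquiv 2 ℂ (S.V × S.L2Prod)).symm.toLinearMap ∘ₗ
    S.operatorFst.prod S.operatorSnd

/-- The natural energy `½ ∑_j ∫ (|v_j|² + ρ_j |∂ₓu_j|²)` of the state `U = (u, v)`; along a solution,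
`v = ∂ₜu`. -/
def energy (U : S.EnergySpace) : ℝ :=
  1 / 2 * ∑ j : Fin S.N, ∫ x in Ioo ((j : ℕ) : ℝ) (((j : ℕ) : ℝ) + 1),
    (‖U.snd j x‖ ^ 2 + S.ρ j * ‖U.fst.dx j x‖ ^ 2)

end EnergySpace

/-! ### Abstract evolution equations `U' = A U` for an unbounded operator `A` -/

section Evolution

variable {E : Type*} [NormedAddCommGroup E] [NormedSpace ℂ E]

/-- `T` is a strongly continuous semigroup of contractions on `E` (only times `t ≥ 0` matter). -/
structure IsContractionSemigroup (T : ℝ → E →L[ℂ] E) : Prop where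
  map_zero : T 0 = ContinuousLinearMap.id ℂ E
  map_add : ∀ s t, 0 ≤ s → 0 ≤ t → T (s + t) = (T s).comp (T t)
  strongly_continuous : ∀ x, ContinuousOn (fun t => T t x) (Ici 0)
  norm_le_one : ∀ t, 0 ≤ t → ‖T t‖ ≤ 1

/-- `A`, with its domain, is the infinitesimal generator of `T`. -/
def IsGenerator (A : E →ₗ.[ℂ] E) (T : ℝ → E →L[ℂ] E) : Prop :=
  ∀ x y : E, (x, y) ∈ A.graph ↔
    Tendsto (fun h : ℝ => ((h : ℂ)⁻¹) • (T h x - x)) (𝓝[>] 0) (𝓝 y)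

/-- `U` is a solution in `C([0, ∞), E)` of `U' = A U`, `U(0) = U₀`, in the integrated (mild) sense:
for all `t ≥ 0`, `∫₀ᵗ U` lies in the domain of `A` and `A ∫₀ᵗ U = U(t) - U₀`. -/
structure IsMildSolution (A : E →ₗ.[ℂ] E) (U₀ : E) (U : ℝ → E) : Prop where
  continuousOn : ContinuousOn U (Ici 0)
  integrated : ∀ t, 0 ≤ t → (∫ s in (0 : ℝ)..t, U s, U t - U₀) ∈ A.graph

/-- `U ∈ C([0, ∞), 𝓓(A))`, where the domain carries the graph norm. -/
def ContinuousInDomain (A : E →ₗ.[ℂ] E) (U : ℝ → E) : Prop :=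
  ContinuousOn U (Ici 0) ∧
    ∃ h : ∀ t : Ici (0 : ℝ), U t ∈ A.domain, Continuous fun t : Ici (0 : ℝ) => A ⟨U t, h t⟩

/-- `U` is a classical solution of `U' = A U`, `U(0) = U₀` on `[0, ∞)`: it lies in
`C([0, ∞), 𝓓(A)) ∩ C¹([0, ∞), E)` and satisfies the equation at every time `t ≥ 0`. -/
structure IsClassicalSolution (A : E →ₗ.[ℂ] E) (U₀ : E) (U : ℝ → E) : Prop where
  initial : U 0 = U₀
  continuousInDomain : ContinuousInDomain A U
  contDiffOn : ContDiffOn ℝ 1 U (Ici 0)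
  equation : ∀ t, 0 ≤ t →
    ∃ h : U t ∈ A.domain, HasDerivWithinAt U (A ⟨U t, h⟩) (Ici 0) t

end Evolution

end StringChain

end

/-! The operator `𝓐` is dissipative and maps its domain onto `𝓗`; everything in (i) follows from
these two properties.

Surjectivity amounts to integrating twice. In `𝓐 (u, v) = (f, h)` one must take `v = f`. The flux
`ρ_j ∂ₓu_j` is a primitive of `h`, continuous across the nodes and starting from `f_0(0)` at the
damped end. Then `u` is a primitive of the known `∂ₓu`, fixed by its zero at the right end
(`exists_operator_eq`). Dissipativity is integration by parts on each string: the boundary terms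
telescope along the chain and leave `Re ⟪𝓐 U, U⟫ = -|v_0(0)|²` (`re_inner_operator`).

For a dissipative onto operator on a Hilbert space, closedness, density of the domain and
surjectivity of `r - A` for `r > 0` are consequences. The Yosida approximations `B n` are bounded,
commuting and dissipative, and the limit of `exp (t B n)` is the contraction semigroup
(`exists_semigroup`). Dissipativity also yields the identification of the generator and the
uniqueness of mild solutions, and hence the regularity for data in the domain.

For (ii), the energy is `½ ‖U‖²`, so its derivative along a solution is `Re ⟪𝓐 U, U⟫`. The trace `u
↦ u_0(0)` is continuous on `V`, so it may be differentiated in time along the solution. -/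

noncomputable section

namespace StringChain

/-! ### Surjective dissipative operators on a complex Hilbert space -/

section Dissipative

variable {E : Type*} [NormedAddCommGroup E] [InnerProductSpace ℂ E]

/-- `A` is dissipative and maps its domain onto the whole space. -/
structure IsOntoDissipative (A : E →ₗ.[ℂ] E) : Prop where
  re_inner_nonpos : ∀ x : A.domain, (⟪A x, (x : E)⟫_ℂ).re ≤ 0
  exists_eq : ∀ y : E, ∃ x : A.domain, A x = y

theorem nonpos_of_forall_add_mul_nonpos {α β : ℝ} (h : ∀ t : ℝ, 0 < t → α + t * β ≤ 0) :
    α ≤ 0 := by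
  by_contra! hα
  have hb : 0 < 2 * (|β| + 1) := by positivity
  have h1 := h (α / (2 * (|β| + 1))) (by positivity)
  have h2 : α / (2 * (|β| + 1)) * β ≥ -(α / 2) := by
    have h3 : α / (2 * (|β| + 1)) * (|β| + 1) = α / 2 := by field_simp
    have h4 : 0 < α / (2 * (|β| + 1)) := by positivity
    nlinarith [neg_abs_le β]
  linarith

theorem re_inner_self_eq (x : E) : (⟪x, x⟫_ℂ).re = ‖x‖ ^ 2 := by
  rw [inner_self_eq_norm_sq_to_K]
  norm_cast

theorem eq_zero_of_re_inner_self_nonpos {x : E} (h : (⟪x, x⟫_ℂ).re ≤ 0) : x = 0 := by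
  rw [re_inner_self_eq] at h
  exact norm_eq_zero.1 (pow_eq_zero_iff two_ne_zero |>.1 (le_antisymm h (sq_nonneg _)))

namespace IsOntoDissipative

variable {A : E →ₗ.[ℂ] E}

/-- `A` is closed, by Minty's trick. With `A z = b`, dissipativity at `x n - z + t q` passes to the
limit. Dividing by `t` and letting `t → 0` gives `Re ⟪A q, a - z⟫ ≤ 0` for all `q`. Since `A` is
onto, `A q = a - z` is a possible choice. -/
theorem exists_of_tendsto (hA : IsOntoDissipative A) {x : ℕ → A.domain} {a b : E}
    (ha : Tendsto (fun n => (x n : E)) atTop (𝓝 a)) (hb : Tendsto (fun n => A (x n)) atTop (𝓝 b)) :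
    ∃ z : A.domain, (z : E) = a ∧ A z = b := by
  obtain ⟨z, hz⟩ := hA.exists_eq b
  refine ⟨z, ?_, hz⟩
  have key : ∀ q : A.domain, (⟪A q, a - z⟫_ℂ).re ≤ 0 := by
    intro q
    refine nonpos_of_forall_add_mul_nonpos (β := (⟪A q, (q : E)⟫_ℂ).re) fun t ht => ?_
    have h1 : ∀ n, (⟪A (x n) - A z + (t : ℂ) • A q, (x n : E) - z + (t : ℂ) • (q : E)⟫_ℂ).re
        ≤ 0 := by
      intro n
      have := hA.re_inner_nonpos (x n - z + (t : ℂ) • q)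
      rwa [LinearPMap.map_add, LinearPMap.map_sub, LinearPMap.map_smul] at this
    have h2 : Tendsto (fun n =>
        (⟪A (x n) - A z + (t : ℂ) • A q, (x n : E) - z + (t : ℂ) • (q : E)⟫_ℂ).re) atTop
        (𝓝 (⟪b - A z + (t : ℂ) • A q, a - z + (t : ℂ) • (q : E)⟫_ℂ).re) :=
      (Complex.continuous_re.tendsto _).comp
        (((hb.sub_const _).add_const _).inner ((ha.sub_const _).add_const _))
    have h3 := le_of_tendsto' h2 h1
    rw [hz, sub_self, zero_add, inner_smul_left, Complex.conj_ofReal, Complex.re_ofReal_mul,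
      inner_add_right, inner_smul_right, Complex.add_re, Complex.re_ofReal_mul] at h3
    nlinarith
  obtain ⟨q, hq⟩ := hA.exists_eq (a - z)
  have h := key q
  rw [hq] at h
  exact (sub_eq_zero.1 (eq_zero_of_re_inner_self_nonpos h)).symm

/-- Pair with `x` and apply Cauchy–Schwarz. For `r > 0` this makes `r - A` injective, makes its
range closed, and bounds its inverse by `1 / r`. -/
theorem mul_norm_le (hA : IsOntoDissipative A) {r : ℝ} (x : A.domain) :
    r * ‖(x : E)‖ ≤ ‖(r : ℂ) • (x : E) - A x‖ := by
  have h1 : r * ‖(x : E)‖ ^ 2 ≤ (⟪(r : ℂ) • (x : E) - A x, (x : E)⟫_ℂ).re := by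
    rw [inner_sub_left, inner_smul_left, Complex.conj_ofReal, Complex.sub_re,
      Complex.re_ofReal_mul, re_inner_self_eq]
    linarith [hA.re_inner_nonpos x]
  have h2 := h1.trans ((Complex.re_le_norm _).trans (norm_inner_le_norm _ _))
  rcases (norm_nonneg (x : E)).eq_or_lt' with h0 | h0
  · rw [h0, mul_zero]
    exact norm_nonneg _
  · refine le_of_mul_le_mul_right ?_ h0
    linarith

theorem eq_of_smul_sub_eq (hA : IsOntoDissipative A) {r : ℝ} (hr : 0 < r) {x y : A.domain}
    (h : (r : ℂ) • (x : E) - A x = (r : ℂ) • (y : E) - A y) : x = y := by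
  have h1 := hA.mul_norm_le (r := r) (x - y)
  rw [LinearPMap.map_sub, Submodule.coe_sub, smul_sub,
    show (r : ℂ) • (x : E) - (r : ℂ) • (y : E) - (A x - A y)
      = ((r : ℂ) • (x : E) - A x) - ((r : ℂ) • (y : E) - A y) by abel, h, sub_self,
    norm_zero] at h1
  have h2 : ‖(x : E) - y‖ ≤ 0 := by
    by_contra! hc
    exact absurd h1 (not_le.2 (mul_pos hr hc))
  exact Subtype.ext (sub_eq_zero.1 (norm_le_zero_iff.1 h2))

variable [CompleteSpace E]

/-- A vector orthogonal to the range of `r - A` has the form `A z`, so `‖A z‖² = r Re ⟪z, A z⟫ ≤ 0`;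
hence the range is dense. It is closed because preimages of a Cauchy sequence are Cauchy by
`mul_norm_le` and `A` is closed. -/
theorem exists_smul_sub_eq (hA : IsOntoDissipative A) {r : ℝ} (hr : 0 < r) (y : E) :
    ∃ x : A.domain, (r : ℂ) • (x : E) - A x = y := by
  let L : A.domain →ₗ[ℂ] E := (r : ℂ) • A.domain.subtype - A.toFun
  have hL : ∀ x, L x = (r : ℂ) • (x : E) - A x := fun x => rfl
  have hdense : (LinearMap.range L).topologicalClosure = ⊤ := by
    rw [Submodule.topologicalClosure_eq_top_iff, eq_bot_iff]
    intro w hw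
    obtain ⟨z, rfl⟩ := hA.exists_eq w
    have h1 : ⟪(r : ℂ) • (z : E) - A z, A z⟫_ℂ = 0 :=
      (Submodule.mem_orthogonal _ _).1 hw _ ⟨z, hL z⟩
    rw [inner_sub_left, inner_smul_left, Complex.conj_ofReal, sub_eq_zero] at h1
    have h2 := congrArg Complex.re h1
    rw [Complex.re_ofReal_mul] at h2
    have h3 : (⟪(z : E), A z⟫_ℂ).re ≤ 0 := by
      rw [← inner_conj_symm, Complex.conj_re]
      exact hA.re_inner_nonpos z
    refine eq_zero_of_re_inner_self_nonpos ?_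
    rw [← h2]
    exact mul_nonpos_of_nonneg_of_nonpos hr.le h3
  have hy : y ∈ closure (LinearMap.range L : Set E) := by
    rw [← Submodule.topologicalClosure_coe, hdense]
    trivial
  obtain ⟨s, hs, hsy⟩ := mem_closure_iff_seq_limit.1 hy
  choose x hx using hs
  have hcs : CauchySeq fun n => (x n : E) := by
    rw [Metric.cauchySeq_iff]
    intro ε hε
    obtain ⟨N, hN⟩ := Metric.cauchySeq_iff.1 hsy.cauchySeq (r * ε) (by positivity)
    refine ⟨N, fun m hm n hn => ?_⟩
    have h1 := hA.mul_norm_le (r := r) (x m - x n)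
    rw [← hL, map_sub, hx, hx, ← dist_eq_norm, Submodule.coe_sub, ← dist_eq_norm] at h1
    exact lt_of_mul_lt_mul_left (h1.trans_lt (hN m hm n hn)) hr.le
  obtain ⟨a, ha⟩ := cauchySeq_tendsto_of_complete hcs
  have hAx : Tendsto (fun n => A (x n)) atTop (𝓝 ((r : ℂ) • a - y)) := by
    refine ((ha.const_smul (r : ℂ)).sub hsy).congr fun n => ?_
    rw [← hx n, hL]
    abel
  obtain ⟨z, hz1, hz2⟩ := hA.exists_of_tendsto ha hAx
  exact ⟨z, by rw [hz1, hz2]; abel⟩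

/-- Write a vector orthogonal to the domain as `z - A z`; pairing it with `z` gives `‖z‖² = Re ⟪z, A
z⟫ ≤ 0`. -/
theorem dense_domain (hA : IsOntoDissipative A) : Dense (A.domain : Set E) := by
  have h : A.domain.topologicalClosure = ⊤ := by
    rw [Submodule.topologicalClosure_eq_top_iff, eq_bot_iff]
    intro w hw
    obtain ⟨z, rfl⟩ := hA.exists_smul_sub_eq one_pos w
    have h1 : ⟪(z : E), ((1 : ℝ) : ℂ) • (z : E) - A z⟫_ℂ = 0 :=
      (Submodule.mem_orthogonal _ _).1 hw _ z.2
    have h3 : (⟪(z : E), A z⟫_ℂ).re ≤ 0 := by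
      rw [← inner_conj_symm, Complex.conj_re]
      exact hA.re_inner_nonpos z
    rw [Complex.ofReal_one, one_smul, inner_sub_right, sub_eq_zero] at h1
    have h2 : z = 0 := Subtype.ext (eq_zero_of_re_inner_self_nonpos (by rw [h1]; exact h3))
    simp [h2]
  intro x
  rw [← Submodule.topologicalClosure_coe, h]
  trivial

theorem exists_resolvent (hA : IsOntoDissipative A) {r : ℝ} (hr : 0 < r) :
    ∃ R : E →L[ℂ] E, (∀ y, r * ‖R y‖ ≤ ‖y‖) ∧
      (∀ y, ∃ x : A.domain, (x : E) = R y ∧ A x = (r : ℂ) • R y - y) ∧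
      ∀ x : A.domain, R ((r : ℂ) • (x : E) - A x) = x := by
  choose f hf using hA.exists_smul_sub_eq hr
  have huniq : ∀ (x : A.domain) y, (r : ℂ) • (x : E) - A x = y → f y = x := fun x y h =>
    hA.eq_of_smul_sub_eq hr ((hf y).trans h.symm)
  let L : E →ₗ[ℂ] E :=
    { toFun := fun y => f y
      map_add' := fun y z => by
        rw [huniq (f y + f z), Submodule.coe_add]
        rw [LinearPMap.map_add, Submodule.coe_add, smul_add, add_sub_add_comm, hf, hf]
      map_smul' := fun c y => by
        rw [huniq (c • f y), Submodule.coe_smul, RingHom.id_apply]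
        rw [LinearPMap.map_smul, Submodule.coe_smul, smul_comm, ← smul_sub, hf] }
  have hL : ∀ y, L y = f y := fun _ => rfl
  have hbound : ∀ y, r * ‖(f y : E)‖ ≤ ‖y‖ := fun y => by
    have := hA.mul_norm_le (r := r) (f y)
    rwa [hf] at this
  refine ⟨L.mkContinuous r⁻¹ fun y => ?_, fun y => ?_, fun y => ⟨f y, rfl, ?_⟩, fun x => ?_⟩
  · rw [hL, le_inv_mul_iff₀ hr]
    exact hbound y
  · exact hbound y
  · rw [LinearMap.mkContinuous_apply, hL, eq_sub_iff_add_eq, ← eq_sub_iff_add_eq', hf]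
  · rw [LinearMap.mkContinuous_apply, hL, huniq x _ rfl]

end IsOntoDissipative

end Dissipative

/-! ### Yosida approximation -/

section Yosida

variable {E : Type*} [NormedAddCommGroup E] [InnerProductSpace ℂ E]

theorem hasDerivWithinAt_norm_sq {u : ℝ → E} {u' : E} {s : Set ℝ} {t : ℝ}
    (hu : HasDerivWithinAt u u' s t) :
    HasDerivWithinAt (fun r => ‖u r‖ ^ 2) (2 * (⟪u', u t⟫_ℂ).re) s t := by
  have h1 := hu.inner ℂ hu
  have h2 := (Complex.reCLM.hasFDerivAt.comp_hasDerivWithinAt t h1)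
  have h3 : (Complex.reCLM ∘ fun r => ⟪u r, u r⟫_ℂ) = fun r => ‖u r‖ ^ 2 :=
    funext fun r => re_inner_self_eq (u r)
  rw [h3] at h2
  refine h2.congr_deriv ?_
  rw [Complex.reCLM_apply, Complex.add_re, ← inner_conj_symm (u t) u', Complex.conj_re]
  ring

/-- Serves twice: for the contractivity of `exp (t B)` with `B` bounded dissipative, and for the
uniqueness of mild solutions. -/
theorem norm_le_norm_of_re_inner_nonpos {u u' : ℝ → E}
    (hu : ∀ t, 0 ≤ t → HasDerivWithinAt u (u' t) (Ici 0) t)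
    (h : ∀ t, 0 ≤ t → (⟪u' t, u t⟫_ℂ).re ≤ 0) {t : ℝ} (ht : 0 ≤ t) : ‖u t‖ ≤ ‖u 0‖ := by
  have hd := fun t ht => hasDerivWithinAt_norm_sq (hu t ht)
  have hanti : AntitoneOn (fun r => ‖u r‖ ^ 2) (Ici 0) := by
    refine antitoneOn_of_hasDerivWithinAt_nonpos (convex_Ici 0)
      (fun t ht => (hd t ht).continuousWithinAt)
      (fun t ht => (hd t (interior_subset ht)).mono interior_subset) fun t ht => ?_
    linarith [h t (interior_subset ht)]
  exact (sq_le_sq₀ (norm_nonneg _) (norm_nonneg _)).1 (hanti (mem_Ici.2 le_rfl) ht ht)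

variable {A : E →ₗ.[ℂ] E}

/-- Bounded dissipative operators `B n`, commuting with each other, that converge strongly to `A`
on the domain of `A`. -/
structure IsYosidaApprox (A : E →ₗ.[ℂ] E) (B : ℕ → E →L[ℂ] E) : Prop where
  re_inner_nonpos : ∀ n x, (⟪B n x, x⟫_ℂ).re ≤ 0
  commute : ∀ n m, Commute (B n) (B m)
  norm_le : ∀ n (x : A.domain), ‖B n x‖ ≤ ‖A x‖
  tendsto : ∀ x : A.domain, Tendsto (fun n => B n x) atTop (𝓝 (A x))


theorem tendsto_of_dense [CompleteSpace E] {L : ℕ → E →L[ℂ] E} {D : Set E} (hD : Dense D)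
    (hL : ∀ n x, ‖L n x‖ ≤ ‖x‖) (h : ∀ x ∈ D, CauchySeq fun n => L n x) (x : E) :
    ∃ y, Tendsto (fun n => L n x) atTop (𝓝 y) := by
  refine cauchySeq_tendsto_of_complete ?_
  rw [Metric.cauchySeq_iff]
  intro ε hε
  obtain ⟨z, hz, hxz⟩ := hD.exists_dist_lt x (ε := ε / 3) (by positivity)
  obtain ⟨N, hN⟩ := Metric.cauchySeq_iff.1 (h z hz) (ε / 3) (by positivity)
  refine ⟨N, fun m hm n hn => ?_⟩
  have h1 : ∀ k, dist (L k x) (L k z) < ε / 3 := fun k => by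
    rw [dist_eq_norm, ← map_sub]
    exact (hL k _).trans_lt (by rwa [← dist_eq_norm])
  have h2 := h1 m
  have h3 := h1 n
  have h4 := hN m hm n hn
  have h5 := dist_triangle4_right (L m x) (L n x) (L m z) (L n z)
  linarith

theorem tendsto_of_dense_of_eq {L : ℕ → E →L[ℂ] E} {M : E →L[ℂ] E} {D : Set E} (hD : Dense D)
    (hL : ∀ n x, ‖L n x‖ ≤ ‖x‖) (hM : ∀ x, ‖M x‖ ≤ ‖x‖)
    (h : ∀ x ∈ D, Tendsto (fun n => L n x) atTop (𝓝 (M x))) (x : E) :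
    Tendsto (fun n => L n x) atTop (𝓝 (M x)) := by
  rw [Metric.tendsto_atTop]
  intro ε hε
  obtain ⟨z, hz, hxz⟩ := hD.exists_dist_lt x (ε := ε / 3) (by positivity)
  obtain ⟨N, hN⟩ := Metric.tendsto_atTop.1 (h z hz) (ε / 3) (by positivity)
  refine ⟨N, fun n hn => ?_⟩
  have h2 : dist (L n x) (L n z) < ε / 3 := by
    rw [dist_eq_norm, ← map_sub]
    exact (hL n _).trans_lt (by rwa [← dist_eq_norm])
  have h3 : dist (M x) (M z) < ε / 3 := by
    rw [dist_eq_norm, ← map_sub]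
    exact (hM _).trans_lt (by rwa [← dist_eq_norm])
  have h4 := hN n hn
  have h5 := dist_triangle4_right (L n x) (M x) (L n z) (M z)
  linarith

/-- With `R n = (r n - A)⁻¹`, the approximation is `B n = r² R n - r = r A R n` for `r = n + 1`. On
the domain `B n x = r R n (A x)`, and the contractions `r R n` tend strongly to the identity,
because `r R n x - x = R n (A x)` has norm at most `‖A x‖ / r`. -/
theorem IsOntoDissipative.exists_yosidaApprox [CompleteSpace E] (hA : IsOntoDissipative A) :
    ∃ B : ℕ → E →L[ℂ] E, IsYosidaApprox A B := by
  let r : ℕ → ℝ := fun n => n + 1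
  have hr : ∀ n, 0 < r n := fun n => by positivity
  choose R hR1 hR2 hR3 using fun n => hA.exists_resolvent (hr n)
  have hRA : ∀ n (x : A.domain), (r n : ℂ) • R n x - x = R n (A x) := fun n x => by
    have h := hR3 n x
    rw [map_sub, map_smul, sub_eq_iff_eq_add] at h
    rw [h, add_sub_cancel_left]
  have hnorm : ∀ n y, ‖((r n : ℂ) • R n) y‖ ≤ ‖y‖ := fun n y => by
    rw [smul_apply, norm_smul, Complex.norm_real, Real.norm_eq_abs,
      abs_of_pos (hr n)]
    exact hR1 n y
  -- The resolvent identity `hres`, written for `(n, m)` and for `(m, n)`, forces the two products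
  -- to agree once `r m - r n` is cancelled.
  have hcommR : ∀ n m y, R n (R m y) = R m (R n y) := by
    have hres : ∀ n m y, R n y - R m y = ((r m : ℂ) - r n) • R m (R n y) := fun n m y => by
      obtain ⟨x, hx1, hx2⟩ := hR2 n y
      have h := hR3 m x
      rw [hx2, hx1, map_sub, map_sub, map_smul, map_smul] at h
      rw [sub_smul]
      nth_rewrite 1 [← h]
      abel
    intro n m y
    rcases eq_or_ne n m with rfl | hnm
    · rfl
    · have h1 := hres n m y
      have h2 := hres m n y
      have hne : (r m : ℂ) - r n ≠ 0 := by
        rw [sub_ne_zero]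
        intro hc
        have : r m = r n := by exact_mod_cast hc
        exact hnm (by simpa [r] using this.symm)
      have h3 : ((r m : ℂ) - r n) • (R m (R n y) - R n (R m y)) = 0 := by
        rw [smul_sub, ← h1, ← neg_sub (r n : ℂ), neg_smul, ← h2]
        abel
      exact (sub_eq_zero.1 ((smul_eq_zero.1 h3).resolve_left hne)).symm
  have hBA : ∀ n (x : A.domain), (((r n : ℂ) * r n) • R n - (r n : ℂ) • (1 : E →L[ℂ] E)) x
      = ((r n : ℂ) • R n) (A x) := fun n x => by
    simp only [sub_apply, smul_apply,
      one_apply_eq_self]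
    rw [← hRA, mul_smul, smul_sub]
  refine ⟨fun n => ((r n : ℂ) * r n) • R n - (r n : ℂ) • (1 : E →L[ℂ] E),
    fun n x => ?_, fun n m => ?_, fun n x => ?_, fun x => ?_⟩
  · obtain ⟨z, hz1, hz2⟩ := hR2 n x
    have h1 : (((r n : ℂ) * r n) • R n - (r n : ℂ) • (1 : E →L[ℂ] E)) x = (r n : ℂ) • A z := by
      simp only [sub_apply, smul_apply,
        one_apply_eq_self]
      rw [hz2, mul_smul, smul_sub]
    -- In terms of `z = R n x`, `Re ⟪B n x, x⟫ = r (r Re ⟪A z, z⟫ - ‖A z‖²)`, which is visibly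
    -- nonpositive.
    have h2 : x = (r n : ℂ) • (z : E) - A z := by rw [hz2, hz1]; abel
    rw [h1, h2, inner_smul_left, Complex.conj_ofReal, Complex.re_ofReal_mul, inner_sub_right,
      inner_smul_right, Complex.sub_re, Complex.re_ofReal_mul, re_inner_self_eq]
    refine mul_nonpos_of_nonneg_of_nonpos (hr n).le ?_
    have h3 := mul_nonpos_of_nonneg_of_nonpos (hr n).le (hA.re_inner_nonpos z)
    nlinarith [sq_nonneg ‖A z‖]
  · have h : Commute (R n) (R m) := ContinuousLinearMap.ext fun y => hcommR n m y
    exact ((h.smul_left _).smul_right _ |>.sub_right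
      ((Commute.one_right _).smul_right _ |>.smul_left _) |>.sub_left
      (((Commute.one_left _).smul_left _)))
  · rw [hBA]
    exact hnorm n _
  · simp_rw [hBA]
    refine tendsto_of_dense_of_eq (M := ContinuousLinearMap.id ℂ E) hA.dense_domain hnorm
      (fun _ => le_rfl) (fun y hy => ?_) (A x)
    rw [ContinuousLinearMap.id_apply, tendsto_iff_norm_sub_tendsto_zero]
    have hlim : Tendsto (fun n => ‖A ⟨y, hy⟩‖ / r n) atTop (𝓝 0) :=
      Tendsto.div_atTop tendsto_const_nhds
        (tendsto_atTop_add_const_right _ _ tendsto_natCast_atTop_atTop)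
    refine squeeze_zero (fun n => norm_nonneg _) (fun n => ?_) hlim
    rw [smul_apply, hRA n ⟨y, hy⟩, le_div_iff₀ (hr n), mul_comm]
    exact hR1 n _

end Yosida

/-! ### The semigroup generated by a surjective dissipative operator -/

section Semigroup

variable {E : Type*} [NormedAddCommGroup E] [InnerProductSpace ℂ E] [CompleteSpace E]

theorem hasDerivAt_exp_smul_apply (B : E →L[ℂ] E) (x : E) (t : ℝ) :
    HasDerivAt (fun s : ℝ => NormedSpace.exp (s • B) x) (NormedSpace.exp (t • B) (B x)) t :=
  (((ContinuousLinearMap.apply ℂ E x).restrictScalars ℝ).hasFDerivAt.comp_hasDerivAt t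
    (hasDerivAt_exp_smul_const B t))

theorem exp_smul_apply_comm (B : E →L[ℂ] E) (x : E) (t : ℝ) :
    NormedSpace.exp (t • B) (B x) = B (NormedSpace.exp (t • B) x) :=
  congrArg (fun L : E →L[ℂ] E => L x) ((Commute.refl B).smul_left t).exp_left.eq

theorem norm_exp_smul_apply_le {B : E →L[ℂ] E} (hB : ∀ x, (⟪B x, x⟫_ℂ).re ≤ 0) {t : ℝ}
    (ht : 0 ≤ t) (x : E) : ‖NormedSpace.exp (t • B) x‖ ≤ ‖x‖ := by
  have h := norm_le_norm_of_re_inner_nonpos (u := fun s : ℝ => NormedSpace.exp (s • B) x)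
    (fun s _ => (hasDerivAt_exp_smul_apply B x s).hasDerivWithinAt)
    (fun s _ => by rw [exp_smul_apply_comm]; exact hB _) ht
  simpa using h

theorem norm_exp_smul_sub_le {B : E →L[ℂ] E} (hB : ∀ x, (⟪B x, x⟫_ℂ).re ≤ 0) {s t : ℝ}
    (hs : 0 ≤ s) (ht : 0 ≤ t) (x : E) :
    ‖NormedSpace.exp (t • B) x - NormedSpace.exp (s • B) x‖ ≤ ‖B x‖ * |t - s| :=
  (convex_Ici (0 : ℝ)).norm_image_sub_le_of_norm_hasDerivWithin_le
    (fun r _ => (hasDerivAt_exp_smul_apply B x r).hasDerivWithinAt)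
    (fun _ hr => norm_exp_smul_apply_le hB hr _) hs ht

/-- The path `exp ((t - s) C) exp (s B) x` joins `exp (t C) x` to `exp (t B) x`. As `B` and `C`
commute, its velocity is two contractions applied to `B x - C x`. -/
theorem norm_exp_smul_sub_exp_smul_le {B C : E →L[ℂ] E} (hB : ∀ x, (⟪B x, x⟫_ℂ).re ≤ 0)
    (hC : ∀ x, (⟪C x, x⟫_ℂ).re ≤ 0) (hBC : Commute B C) {t : ℝ} (ht : 0 ≤ t) (x : E) :
    ‖NormedSpace.exp (t • B) x - NormedSpace.exp (t • C) x‖ ≤ ‖B x - C x‖ * t := by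
  let w : ℝ → E := fun s => NormedSpace.exp ((t - s) • C) (NormedSpace.exp (s • B) x)
  have hw : ∀ s, HasDerivAt w
      (NormedSpace.exp ((t - s) • C) (NormedSpace.exp (s • B) (B x - C x))) s := by
    intro s
    have h1 : HasDerivAt (fun s : ℝ => NormedSpace.exp ((t - s) • C))
        (-(NormedSpace.exp ((t - s) • C) * C)) s := by
      have := (hasDerivAt_exp_smul_const C (t - s)).scomp s ((hasDerivAt_id s).const_sub t)
      exact this.congr_deriv (by simp)
    have h2 := (hasDerivAt_exp_smul_apply B x s)
    have h3 := ((ContinuousLinearMap.restrictScalarsL ℂ E E ℝ ℝ).hasFDerivAt.comp_hasDerivAt s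
      h1).clm_apply h2
    refine h3.congr_deriv ?_
    have h4 : C (NormedSpace.exp (s • B) x) = NormedSpace.exp (s • B) (C x) :=
      congrArg (fun L : E →L[ℂ] E => L x) (hBC.smul_left s).exp_left.eq.symm
    simp [h4, map_sub]
    abel
  have h := norm_image_sub_le_of_norm_deriv_le_segment' (a := 0) (b := t) (f := w)
    (fun s _ => (hw s).hasDerivWithinAt) (C := ‖B x - C x‖) (fun s hs =>
      (norm_exp_smul_apply_le hC (sub_nonneg.2 hs.2.le) _).trans
        (norm_exp_smul_apply_le hB hs.1 _)) t ⟨ht, le_rfl⟩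
  simpa [w] using h

variable {A : E →ₗ.[ℂ] E}

/-- The properties by which the semigroup generated by a dissipative operator is constructed. -/
structure IsSemigroupFor (A : E →ₗ.[ℂ] E) (T : ℝ → E →L[ℂ] E) : Prop where
  map_zero : ∀ x, T 0 x = x
  map_add : ∀ s t, 0 ≤ s → 0 ≤ t → ∀ x, T (s + t) x = T s (T t x)
  norm_le : ∀ t x, ‖T t x‖ ≤ ‖x‖
  continuous : ∀ x, Continuous fun t => T t x
  integral : ∀ x : A.domain, ∀ t, 0 ≤ t → T t x = x + ∫ s in (0 : ℝ)..t, T s (A x)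

/-- On the domain `exp (t B n) x` is Cauchy, since two terms differ by at most `t ‖B m x - B n x‖`;
density and contractivity extend this to all `x`. -/
theorem IsOntoDissipative.exists_semigroup (hA : IsOntoDissipative A) :
    ∃ T : ℝ → E →L[ℂ] E, IsSemigroupFor A T := by
  obtain ⟨B, hB⟩ := hA.exists_yosidaApprox
  -- Negative times are clamped to `0`, so that the bounds and the continuity hold on all of `ℝ`.
  let e : ℕ → ℝ → E →L[ℂ] E := fun n t => NormedSpace.exp (max t 0 • B n)
  have he : ∀ n t, 0 ≤ t → e n t = NormedSpace.exp (t • B n) := fun n t ht => by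
    simp only [e, max_eq_left ht]
  have hnorm : ∀ t n x, ‖e n t x‖ ≤ ‖x‖ := fun t n x =>
    norm_exp_smul_apply_le (hB.re_inner_nonpos n) (le_max_right _ _) x
  have hconv : ∀ t x, ∃ y, Tendsto (fun n => e n t x) atTop (𝓝 y) := by
    intro t
    refine tendsto_of_dense hA.dense_domain (hnorm t) fun x hx => ?_
    rw [Metric.cauchySeq_iff]
    intro ε hε
    have hp : 0 < max t 0 + 1 := by positivity
    obtain ⟨N, hN⟩ := Metric.cauchySeq_iff.1 (hB.tendsto ⟨x, hx⟩).cauchySeq (ε / (max t 0 + 1))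
      (by positivity)
    refine ⟨N, fun m hm n hn => ?_⟩
    have h1 := norm_exp_smul_sub_exp_smul_le (hB.re_inner_nonpos m) (hB.re_inner_nonpos n)
      (hB.commute m n) (le_max_right t 0) x
    have h2 := hN m hm n hn
    rw [dist_eq_norm, lt_div_iff₀ hp] at h2
    rw [dist_eq_norm]
    refine (h1.trans ?_).trans_lt h2
    gcongr
    linarith
  choose F hF using hconv
  let T : ℝ → E →L[ℂ] E := fun t => continuousLinearMapOfTendsto (e · t) (f := F t)
    (tendsto_pi_nhds.2 (hF t))
  have hT : ∀ t x, Tendsto (fun n => e n t x) atTop (𝓝 (T t x)) := hF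
  have hTnorm : ∀ t x, ‖T t x‖ ≤ ‖x‖ := fun t x =>
    le_of_tendsto' (hT t x).norm fun n => hnorm t n x
  refine ⟨T, fun x => ?_, fun s t hs ht x => ?_, hTnorm, fun x => ?_, fun x t ht => ?_⟩
  · refine tendsto_nhds_unique (hT 0 x) ?_
    simp [e]
  · let _ : NormedAlgebra ℚ (E →L[ℂ] E) := NormedAlgebra.restrictScalars ℚ ℂ (E →L[ℂ] E)
    refine tendsto_nhds_unique (hT (s + t) x) ?_
    have h1 : ∀ n, e n (s + t) x = e n s (e n t x - T t x) + e n s (T t x) := fun n => by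
      rw [map_sub, sub_add_cancel, he n _ (add_nonneg hs ht), he n s hs, he n t ht, add_smul,
        NormedSpace.exp_add_of_commute (((Commute.refl _).smul_left s).smul_right t)]
      rfl
    simp_rw [h1]
    rw [← zero_add (T s (T t x))]
    refine Tendsto.add ?_ (hT s _)
    refine squeeze_zero_norm (fun n => hnorm s n _) ?_
    exact tendsto_iff_norm_sub_tendsto_zero.1 (hT t x)
  -- Orbits of domain points `z` are Lipschitz with constant `‖A z‖`, and by contractivity they
  -- approximate the orbit of `x` uniformly in time.
  · refine continuous_of_uniform_approx_of_continuous fun u hu => ?_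
    obtain ⟨ε, hε, hεu⟩ := Metric.mem_uniformity_dist.1 hu
    obtain ⟨z, hz, hxz⟩ := hA.dense_domain.exists_dist_lt x hε
    refine ⟨fun t => T t z, ?_, fun t => hεu ?_⟩
    · refine (LipschitzWith.of_dist_le_mul (K := ‖A ⟨z, hz⟩‖₊) fun t s => ?_).continuous
      rw [dist_eq_norm, dist_eq_norm]
      refine le_of_tendsto' ((hT t z).sub (hT s z)).norm fun n => ?_
      refine (norm_exp_smul_sub_le (hB.re_inner_nonpos n) (le_max_right s 0) (le_max_right t 0)
        z).trans ?_
      exact mul_le_mul (hB.norm_le n ⟨z, hz⟩) (abs_max_sub_max_le_abs t s 0) (abs_nonneg _)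
        (norm_nonneg _)
    · rw [dist_eq_norm, ← map_sub]
      exact (hTnorm t _).trans_lt (by rwa [← dist_eq_norm])
  · have h1 : ∀ n, e n t x = x + ∫ s in (0 : ℝ)..t, e n s (B n x) := fun n => by
      have h2 : ∫ s in (0 : ℝ)..t, e n s (B n x)
          = ∫ s in (0 : ℝ)..t, NormedSpace.exp (s • B n) (B n x) :=
        intervalIntegral.integral_congr fun s hs => by
          rw [uIcc_of_le ht] at hs
          simp only [he n s hs.1]
      have h3 : Continuous fun s : ℝ => NormedSpace.exp (s • B n) (B n x) :=
        continuous_iff_continuousAt.2 fun s =>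
          (hasDerivAt_exp_smul_apply (B n) (B n x) s).continuousAt
      rw [h2, intervalIntegral.integral_eq_sub_of_hasDerivAt
        (fun s _ => hasDerivAt_exp_smul_apply (B n) (x : E) s) (h3.intervalIntegrable _ _),
        he n t ht]
      simp
    refine tendsto_nhds_unique (hT t x) ?_
    simp_rw [h1]
    refine tendsto_const_nhds.add ?_
    refine intervalIntegral.tendsto_integral_filter_of_dominated_convergence
      (fun _ => ‖A x‖) ?_ ?_ intervalIntegrable_const ?_
    · refine Eventually.of_forall fun n => Continuous.aestronglyMeasurable ?_
      have h3 : Continuous fun s : ℝ => NormedSpace.exp (s • B n) (B n x) :=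
        continuous_iff_continuousAt.2 fun s =>
          (hasDerivAt_exp_smul_apply (B n) (B n x) s).continuousAt
      exact h3.comp (continuous_id.max continuous_const)
    · exact Eventually.of_forall fun n => Eventually.of_forall fun s _ =>
        (hnorm s n _).trans (hB.norm_le n x)
    · refine Eventually.of_forall fun s _ => ?_
      have h1 : ∀ n, e n s (B n x) = e n s (B n x - A x) + e n s (A x) := fun n => by
        rw [map_sub, sub_add_cancel]
      simp_rw [h1]
      rw [← zero_add (T s (A x))]
      refine Tendsto.add ?_ (hT s _)
      refine squeeze_zero_norm (fun n => hnorm s n _) ?_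
      exact tendsto_iff_norm_sub_tendsto_zero.1 (hB.tendsto x)

end Semigroup

/-! ### Generator and solutions -/

section Solutions

theorem tendsto_slope_of_hasDerivWithinAt {E : Type*} [NormedAddCommGroup E] [NormedSpace ℂ E]
    {f : ℝ → E} {f' : E} {t : ℝ} (h : HasDerivWithinAt f f' (Ioi t) t) :
    Tendsto (fun h : ℝ => ((h : ℂ)⁻¹) • (f (t + h) - f t)) (𝓝[>] 0) (𝓝 f') := by
  rw [hasDerivWithinAt_iff_tendsto_slope' self_notMem_Ioi] at h
  have h1 : Tendsto (fun r : ℝ => t + r) (𝓝[>] 0) (𝓝[>] t) := by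
    refine tendsto_nhdsWithin_iff.2 ⟨?_, ?_⟩
    · have : Tendsto (fun r : ℝ => t + r) (𝓝 0) (𝓝 (t + 0)) := tendsto_const_nhds.add tendsto_id
      rw [add_zero] at this
      exact this.mono_left nhdsWithin_le_nhds
    · filter_upwards [self_mem_nhdsWithin] with r hr
      exact lt_add_of_pos_right t hr
  refine (h.comp h1).congr fun r => ?_
  rw [Function.comp_apply, slope_def_module, add_sub_cancel_left, ← Complex.ofReal_inv,
    Complex.coe_smul]

variable {E : Type*} [NormedAddCommGroup E] [InnerProductSpace ℂ E]
  {A : E →ₗ.[ℂ] E} {T : ℝ → E →L[ℂ] E}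

namespace IsSemigroupFor

theorem isContractionSemigroup (hT : IsSemigroupFor A T) : IsContractionSemigroup T where
  map_zero := ContinuousLinearMap.ext hT.map_zero
  map_add s t hs ht := ContinuousLinearMap.ext (hT.map_add s t hs ht)
  strongly_continuous x := (hT.continuous x).continuousOn
  norm_le_one t _ := ContinuousLinearMap.opNorm_le_bound _ zero_le_one fun x => by
    rw [one_mul]
    exact hT.norm_le t x

variable [CompleteSpace E]

theorem hasDerivWithinAt (hT : IsSemigroupFor A T) (x : A.domain) {t : ℝ} (ht : 0 ≤ t) :
    HasDerivWithinAt (fun s => T s x) (T t (A x)) (Ici 0) t := by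
  have h := ((hT.continuous (A x)).integral_hasStrictDerivAt 0 t).hasDerivAt.const_add (x : E)
  exact h.hasDerivWithinAt.congr (fun s hs => hT.integral x s hs) (hT.integral x t ht)

/-- The generator extends `A` and inherits dissipativity from contractivity. If it sends `x` to `y`,
solve `z - A z = x - y`. Then it sends `x - z` to `y - A z = x - z`, which forces `x = z`. -/
theorem isGenerator (hT : IsSemigroupFor A T) (hA : IsOntoDissipative A) : IsGenerator A T := by
  have hfwd : ∀ x : A.domain,
      Tendsto (fun h : ℝ => ((h : ℂ)⁻¹) • (T h x - x)) (𝓝[>] 0) (𝓝 (A x)) := by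
    intro x
    have h1 := tendsto_slope_of_hasDerivWithinAt
      ((hT.hasDerivWithinAt x le_rfl).mono Ioi_subset_Ici_self)
    simpa only [zero_add, hT.map_zero] using h1
  intro x y
  rw [LinearPMap.mem_graph_iff]
  constructor
  · rintro ⟨z, rfl, rfl⟩
    exact hfwd z
  · intro hxy
    obtain ⟨z, hz⟩ := hA.exists_smul_sub_eq one_pos (x - y)
    rw [Complex.ofReal_one, one_smul] at hz
    have h1 := hxy.sub (hfwd z)
    have h2 : y - A z = x - z := by
      rw [sub_eq_sub_iff_add_eq_add] at hz ⊢
      rw [add_comm, ← hz, add_comm]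
    have h3 : ((⟪y - A z, x - z⟫_ℂ).re) ≤ 0 := by
      refine le_of_tendsto ((Complex.continuous_re.tendsto _).comp
        (h1.inner tendsto_const_nhds)) ?_
      filter_upwards [self_mem_nhdsWithin] with h (hh : 0 < h)
      rw [Function.comp_apply, ← smul_sub, ← Complex.ofReal_inv, inner_smul_left,
        Complex.conj_ofReal, Complex.re_ofReal_mul]
      refine mul_nonpos_of_nonneg_of_nonpos (inv_nonneg.2 hh.le) ?_
      rw [show T h x - x - (T h z - z) = T h (x - z) - (x - z) by rw [map_sub]; abel,
        inner_sub_left, Complex.sub_re, re_inner_self_eq]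
      have h4 := (Complex.re_le_norm _).trans (norm_inner_le_norm (𝕜 := ℂ) (T h (x - z)) (x - z))
      have h5 := mul_le_mul_of_nonneg_right (hT.norm_le h (x - z)) (norm_nonneg (x - z))
      nlinarith
    rw [h2] at h3
    have h4 := sub_eq_zero.1 (eq_zero_of_re_inner_self_nonpos h3)
    refine ⟨z, h4.symm, ?_⟩
    rw [h4, sub_self, sub_eq_zero] at h2
    exact h2.symm

theorem isMildSolution (hT : IsSemigroupFor A T) (hA : IsOntoDissipative A) (x : E) :
    IsMildSolution A x fun t => T t x where
  continuousOn := (hT.continuous x).continuousOn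
  integrated t ht := by
    -- By the semigroup law, `T h - 1` applied to `∫₀ᵗ T s x` equals `∫ₜᵗ⁺ʰ - ∫₀ʰ`; divided by `h`,
    -- this tends to `T t x - x`.
    rw [hT.isGenerator hA]
    set F : ℝ → E := fun s => T s x with hF
    have hc : Continuous F := hT.continuous x
    have hd : ∀ r, HasDerivAt (fun r => ∫ s in (0 : ℝ)..r, F s) (F r) r := fun r =>
      (hc.integral_hasStrictDerivAt 0 r).hasDerivAt
    have h1 := (tendsto_slope_of_hasDerivWithinAt (hd t).hasDerivWithinAt).sub
      (tendsto_slope_of_hasDerivWithinAt (hd 0).hasDerivWithinAt)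
    have h0 : F 0 = x := hT.map_zero x
    rw [h0] at h1
    refine h1.congr' ?_
    filter_upwards [self_mem_nhdsWithin] with h (hh : 0 < h)
    rw [← smul_sub]
    congr 1
    have h2 : T h (∫ s in (0 : ℝ)..t, F s) = ∫ s in h..t + h, F s := by
      rw [← ContinuousLinearMap.intervalIntegral_comp_comm _ (hc.intervalIntegrable _ _)]
      rw [show ∫ s in h..t + h, F s = ∫ s in (0 : ℝ) + h..t + h, F s by rw [zero_add],
        ← intervalIntegral.integral_comp_add_right]
      refine intervalIntegral.integral_congr fun s hs => ?_
      rw [uIcc_of_le ht] at hs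
      simp only [hF]
      rw [add_comm s h, hT.map_add h s hh.le hs.1]
    have hi : ∀ a b, IntervalIntegrable F volume a b := fun a b => hc.intervalIntegrable a b
    rw [h2, zero_add, intervalIntegral.integral_same, sub_zero,
      ← intervalIntegral.integral_add_adjacent_intervals (hi 0 h) (hi h (t + h))]
    abel

end IsSemigroupFor

variable [CompleteSpace E]

/-- The integral `Y` of the difference `Z` solves `Y' = Z = A Y` with `Y(0) = 0`. Dissipativity
gives `Y = 0`, and then `Z = A 0 = 0`. -/
theorem IsMildSolution.eqOn (hA : IsOntoDissipative A) {x : E} {U W : ℝ → E}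
    (hU : IsMildSolution A x U) (hW : IsMildSolution A x W) : EqOn W U (Ici 0) := by
  set Z : ℝ → E := fun t => W (max t 0) - U (max t 0) with hZ
  have hm : Continuous fun t : ℝ => max t 0 := continuous_id.max continuous_const
  have hUc : Continuous fun t => U (max t 0) :=
    hU.continuousOn.comp_continuous hm fun t => le_max_right t 0
  have hWc : Continuous fun t => W (max t 0) :=
    hW.continuousOn.comp_continuous hm fun t => le_max_right t 0
  have hc : Continuous Z := hWc.sub hUc
  have hgraph : ∀ t, 0 ≤ t → (∫ s in (0 : ℝ)..t, Z s, Z t) ∈ A.graph := by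
    intro t ht
    have h1 := A.graph.sub_mem (hW.integrated t ht) (hU.integrated t ht)
    have h2 : ∀ V : ℝ → E, ∫ s in (0 : ℝ)..t, V (max s 0) = ∫ s in (0 : ℝ)..t, V s := fun V =>
      intervalIntegral.integral_congr fun s hs => by
        rw [uIcc_of_le ht] at hs
        simp only [max_eq_left hs.1]
    rw [hZ, intervalIntegral.integral_sub (hWc.intervalIntegrable _ _)
      (hUc.intervalIntegrable _ _), h2, h2]
    simp only [max_eq_left ht]
    rw [Prod.mk_sub_mk, sub_sub_sub_cancel_right] at h1
    exact h1
  have hY : ∀ t, 0 ≤ t → ∫ s in (0 : ℝ)..t, Z s = 0 := by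
    intro t ht
    have h1 := norm_le_norm_of_re_inner_nonpos (u := fun t => ∫ s in (0 : ℝ)..t, Z s)
      (fun t _ => (hc.integral_hasStrictDerivAt 0 t).hasDerivAt.hasDerivWithinAt)
      (fun t ht => by
        obtain ⟨y, hy1, hy2⟩ := (LinearPMap.mem_graph_iff A).1 (hgraph t ht)
        simp only at hy1 hy2
        rw [← hy1, ← hy2]
        exact hA.re_inner_nonpos y) ht
    simpa using h1
  intro t ht
  have h1 := hgraph t ht
  rw [hY t ht] at h1
  have h2 : Z t = 0 := A.graph_fst_eq_zero_snd h1 rfl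
  simp only [hZ, max_eq_left (mem_Ici.1 ht)] at h2
  exact sub_eq_zero.1 h2

/-- By uniqueness `U` is the orbit of `x`, and `T t` commutes with `A` on the domain. So `A (U t) =
T t (A x)`, whose continuity gives both regularity claims. -/
theorem IsMildSolution.isClassicalSolution (hA : IsOntoDissipative A) {x : E} (hx : x ∈ A.domain)
    {U : ℝ → E} (hU : IsMildSolution A x U) : IsClassicalSolution A x U := by
  obtain ⟨T, hT⟩ := hA.exists_semigroup
  have hUT : EqOn U (fun t => T t x) (Ici 0) := (hT.isMildSolution hA x).eqOn hA hU
  have hgraph : ∀ t, 0 ≤ t → (U t, T t (A ⟨x, hx⟩)) ∈ A.graph := by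
    intro t ht
    rw [hUT ht, hT.isGenerator hA]
    have h1 := (hT.isGenerator hA x (A ⟨x, hx⟩)).1 (A.mem_graph ⟨x, hx⟩)
    refine (((T t).continuous.tendsto _).comp h1).congr' ?_
    filter_upwards [self_mem_nhdsWithin] with h (hh : 0 < h)
    rw [Function.comp_apply, map_smul, map_sub, ← hT.map_add t h ht hh.le, add_comm t h,
      hT.map_add h t hh.le ht]
  have hdom : ∀ t, 0 ≤ t → ∃ h : U t ∈ A.domain, A ⟨U t, h⟩ = T t (A ⟨x, hx⟩) := by
    intro t ht
    obtain ⟨y, hy1, hy2⟩ := (LinearPMap.mem_graph_iff A).1 (hgraph t ht)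
    simp only at hy1 hy2
    refine ⟨hy1 ▸ y.2, ?_⟩
    rw [← hy2]
    congr 1
    exact Subtype.ext hy1.symm
  have hderiv : ∀ t, 0 ≤ t → HasDerivWithinAt U (T t (A ⟨x, hx⟩)) (Ici 0) t := fun t ht =>
    (hT.hasDerivWithinAt ⟨x, hx⟩ ht).congr hUT (hUT ht)
  have hcont := hT.continuous (A ⟨x, hx⟩)
  refine ⟨?_, ⟨hU.continuousOn, fun t => (hdom t t.2).choose, ?_⟩, ?_, fun t ht => ?_⟩
  · rw [hUT (mem_Ici.2 le_rfl)]
    exact hT.map_zero x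
  · refine (hcont.comp continuous_subtype_val).congr fun t => ?_
    exact (hdom t t.2).choose_spec.symm
  · rw [contDiffOn_one_iff_derivWithin (uniqueDiffOn_Ici 0)]
    refine ⟨fun t ht => (hderiv t ht).differentiableWithinAt, ?_⟩
    exact hcont.continuousOn.congr fun t ht =>
      (hderiv t ht).derivWithin (uniqueDiffOn_Ici 0 t ht)
  · obtain ⟨h, hh⟩ := hdom t ht
    exact ⟨h, hh ▸ hderiv t ht⟩

end Solutions

/-! ### Primitives of integrable functions -/

section Primitive

/-- Increments of the primitive are dominated by those of the real primitive of `‖g‖`. -/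
theorem absolutelyContinuousOnInterval_primitive {F : Type*} [NormedAddCommGroup F]
    [NormedSpace ℝ F] {g : ℝ → F} {a b : ℝ} (hg : IntervalIntegrable g volume a b) (c : F) :
    AbsolutelyContinuousOnInterval (fun x => c + ∫ y in a..x, g y) a b := by
  have h := (absolutelyContinuousOnInterval_iff _ a b).1
    (hg.norm.absolutelyContinuousOnInterval_intervalIntegral (c := a) left_mem_uIcc)
  rw [absolutelyContinuousOnInterval_iff]
  intro ε hε
  obtain ⟨δ, hδ, H⟩ := h ε hε
  refine ⟨δ, hδ, fun P hP hPδ => (Finset.sum_le_sum fun i hi => ?_).trans_lt (H P hP hPδ)⟩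
  obtain ⟨h1, h2⟩ := hP.1 i hi
  have hi1 : IntervalIntegrable g volume a (P.2 i).1 :=
    hg.mono_set (uIcc_subset_uIcc left_mem_uIcc h1)
  have hi2 : IntervalIntegrable g volume a (P.2 i).2 :=
    hg.mono_set (uIcc_subset_uIcc left_mem_uIcc h2)
  rw [dist_add_left, dist_eq_norm, Real.dist_eq,
    intervalIntegral.integral_interval_sub_left hi1 hi2,
    intervalIntegral.integral_interval_sub_left hi1.norm hi2.norm]
  exact intervalIntegral.norm_integral_le_abs_integral_norm

/-- Integration by parts for merely integrable derivatives: `G K` minus the primitive of `G k + g K`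
is absolutely continuous with derivative zero almost everywhere, hence constant. -/
theorem integral_mul_primitive_add {g k : ℝ → ℂ} {a b : ℝ} (hg : IntervalIntegrable g volume a b)
    (hk : IntervalIntegrable k volume a b) (c d : ℂ) :
    ∫ x in a..b, ((c + ∫ y in a..x, g y) * k x + g x * (d + ∫ y in a..x, k y))
      = (c + ∫ y in a..b, g y) * (d + ∫ y in a..b, k y) - c * d := by
  have hG := absolutelyContinuousOnInterval_primitive hg c
  have hK := absolutelyContinuousOnInterval_primitive hk d
  set G : ℝ → ℂ := fun x => c + ∫ y in a..x, g y with hGdef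
  set K : ℝ → ℂ := fun x => d + ∫ y in a..x, k y with hKdef
  have hint : IntervalIntegrable (fun x => G x * k x + g x * K x) volume a b :=
    (hk.continuousOn_mul hG.continuousOn).add (hg.mul_continuousOn hK.continuousOn)
  have hH := (hG.smul hK).sub (absolutelyContinuousOnInterval_primitive hint 0)
  obtain ⟨C, hC⟩ := hH.const_of_ae_hasDerivAt_zero (by
    filter_upwards [hg.ae_hasDerivAt_integral, hk.ae_hasDerivAt_integral,
      hint.ae_hasDerivAt_integral] with x h1 h2 h3 hx
    have d1 := (h1 hx a left_mem_uIcc).const_add c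
    have d2 := (h2 hx a left_mem_uIcc).const_add d
    have d3 := (h3 hx a left_mem_uIcc).const_add 0
    refine ((d1.mul d2).sub d3).congr_deriv ?_
    simp only [hGdef, hKdef]
    ring)
  have h1 := hC a left_mem_uIcc
  have h2 := hC b right_mem_uIcc
  have hGa : G a = c := by simp [hGdef]
  have hKa : K a = d := by simp [hKdef]
  simp only [smul_eq_mul, Pi.sub_apply, Pi.mul_apply, intervalIntegral.integral_same, zero_add,
    sub_zero, hGa, hKa] at h1 h2
  change _ = G b * K b - c * d
  rw [h1, ← h2, sub_sub_cancel]

variable {a b : ℝ}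

theorem L2.intervalIntegrable (hab : a ≤ b) (g : L2 a b) : IntervalIntegrable g volume a b :=
  (intervalIntegrable_iff_integrableOn_Ioo_of_le hab).2 (L2.integrable g)

theorem setIntegral_Ioo_eq {F : Type*} [NormedAddCommGroup F] [NormedSpace ℝ F] (hab : a ≤ b)
    (f : ℝ → F) : ∫ x in Ioo a b, f x = ∫ x in a..b, f x := by
  rw [intervalIntegral.integral_of_le hab, integral_Ioc_eq_integral_Ioo]

theorem L2.continuousOn_primitive (hab : a ≤ b) (g : L2 a b) (c : ℂ) :
    ContinuousOn (fun x => c + ∫ y in a..x, g y) (Icc a b) := by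
  rw [← uIcc_of_le hab]
  exact (absolutelyContinuousOnInterval_primitive (g.intervalIntegrable hab) c).continuousOn

theorem L2.hasValueAt_of_ae_eq_primitive (hab : a ≤ b) {u g : L2 a b} {c : ℂ}
    (h : u =ᵐ[volume.restrict (Ioo a b)] fun x => c + ∫ y in a..x, g y) (x : ℝ) :
    HasValueAt u x (c + ∫ y in a..x, g y) :=
  ⟨_, L2.continuousOn_primitive hab g c, h, rfl⟩

theorem L2.exists_primitive (hab : a ≤ b) (g : L2 a b) (c : ℂ) :
    ∃ u : L2 a b, (u =ᵐ[volume.restrict (Ioo a b)] fun x => c + ∫ y in a..x, g y) ∧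
      HasWeakDeriv u g := by
  have hcont := L2.continuousOn_primitive hab g c
  obtain ⟨M, hM⟩ := isCompact_Icc.exists_bound_of_continuousOn hcont
  have hmem : MemLp (fun x => c + ∫ y in a..x, g y) 2 (volume.restrict (Ioo a b)) := by
    refine MemLp.of_bound ((hcont.mono Ioo_subset_Icc_self).aestronglyMeasurable
      measurableSet_Ioo) M ?_
    filter_upwards [ae_restrict_mem measurableSet_Ioo] with x hx
    exact hM x (Ioo_subset_Icc_self hx)
  refine ⟨hmem.toLp, hmem.coeFn_toLp, fun φ hφ => ?_⟩
  have hφa : φ a = 0 := image_eq_zero_of_notMem_tsupport fun h => (hφ.tsupport_subset h).1.false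
  have hφb : φ b = 0 := image_eq_zero_of_notMem_tsupport fun h => (hφ.tsupport_subset h).2.false
  have hd' : Continuous fun x => ((deriv φ x : ℝ) : ℂ) :=
    Complex.continuous_ofReal.comp hφ.deriv.contDiff.continuous
  have hprim : ∀ x, ∫ y in a..x, ((deriv φ y : ℝ) : ℂ) = φ x := fun x => by
    rw [intervalIntegral.integral_ofReal, intervalIntegral.integral_deriv_eq_sub
      (fun y _ => (hφ.contDiff.differentiable (by simp)).differentiableAt)
      (hφ.deriv.contDiff.continuous.intervalIntegrable _ _), hφa, sub_zero]
  -- A test function is the primitive of its derivative, with starting value `0`; both boundary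
  -- terms vanish because `φ a = φ b = 0`.
  have key := integral_mul_primitive_add (hd'.intervalIntegrable a b)
    (g.intervalIntegrable hab) 0 c
  simp only [zero_add, hprim, hφb, Complex.ofReal_zero, zero_mul, sub_zero] at key
  have i1 : IntervalIntegrable (fun x => (φ x : ℂ) * g x) volume a b :=
    (g.intervalIntegrable hab).continuousOn_mul
      (Complex.continuous_ofReal.comp hφ.contDiff.continuous).continuousOn
  have i2 : IntervalIntegrable (fun x => ((deriv φ x : ℝ) : ℂ) * (c + ∫ y in a..x, g y))
      volume a b :=
    ContinuousOn.intervalIntegrable (hd'.continuousOn.mul (by rwa [uIcc_of_le hab]))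
  rw [intervalIntegral.integral_add i1 i2] at key
  have e1 : ∫ x in Ioo a b, deriv φ x • (hmem.toLp : L2 a b) x
      = ∫ x in a..b, ((deriv φ x : ℝ) : ℂ) * (c + ∫ y in a..x, g y) := by
    rw [← setIntegral_Ioo_eq hab]
    refine integral_congr_ae ?_
    filter_upwards [hmem.coeFn_toLp] with x hx
    rw [hx, Complex.real_smul]
  rw [e1, setIntegral_Ioo_eq hab]
  simp_rw [Complex.real_smul]
  linear_combination key

/-- Subtracting a primitive of `g` leaves weak derivative zero, that is, a constant. This supplies
the continuous representatives behind all boundary values. -/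
theorem HasWeakDeriv.exists_ae_eq_primitive (hab : a < b) {u g : L2 a b} (h : HasWeakDeriv u g) :
    ∃ c : ℂ, u =ᵐ[volume.restrict (Ioo a b)] fun x => c + ∫ y in a..x, g y := by
  obtain ⟨w, hw, hwg⟩ := L2.exists_primitive hab.le g 0
  have h1 := h.add (hwg.smul (-1))
  rw [neg_one_smul, neg_one_smul, add_neg_cancel] at h1
  obtain ⟨c, hc⟩ := exists_const_of_hasWeakDeriv_zero hab h1
  refine ⟨c, ?_⟩
  filter_upwards [hw, hc, Lp.coeFn_add u (-w), Lp.coeFn_neg w] with x h1 h2 h3 h4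
  rw [h3, Pi.add_apply, h4, Pi.neg_apply, h1] at h2
  linear_combination h2

theorem MemH1.exists_hasValueAt (hab : a < b) {u : L2 a b} (h : MemH1 u) (x : ℝ) :
    ∃ c, HasValueAt u x c := by
  obtain ⟨c, hc⟩ := h.hasWeakDeriv.exists_ae_eq_primitive hab
  exact ⟨_, L2.hasValueAt_of_ae_eq_primitive hab.le hc x⟩

/-- Integration by parts in `H¹(a, b)`. -/
theorem HasWeakDeriv.inner_add_inner (hab : a < b) {u g w k : L2 a b} (hu : HasWeakDeriv u g)
    (hw : HasWeakDeriv w k) {ua ub wa wb : ℂ} (hua : HasValueAt u a ua) (hub : HasValueAt u b ub)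
    (hwa : HasValueAt w a wa) (hwb : HasValueAt w b wb) :
    ⟪u, k⟫_ℂ + ⟪g, w⟫_ℂ = starRingEnd ℂ ub * wb - starRingEnd ℂ ua * wa := by
  obtain ⟨c, hc⟩ := hu.exists_ae_eq_primitive hab
  obtain ⟨d, hd⟩ := hw.exists_ae_eq_primitive hab
  have hL : a ∈ Icc a b := left_mem_Icc.2 hab.le
  have hR : b ∈ Icc a b := right_mem_Icc.2 hab.le
  rw [hua.unique hab hL (L2.hasValueAt_of_ae_eq_primitive hab.le hc a),
    hub.unique hab hR (L2.hasValueAt_of_ae_eq_primitive hab.le hc b),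
    hwa.unique hab hL (L2.hasValueAt_of_ae_eq_primitive hab.le hd a),
    hwb.unique hab hR (L2.hasValueAt_of_ae_eq_primitive hab.le hd b)]
  have hconj : ∀ x, ∫ y in a..x, starRingEnd ℂ (g y) = starRingEnd ℂ (∫ y in a..x, g y) :=
    fun x => by simp only [intervalIntegral, integral_conj, map_sub]
  have hgc : IntervalIntegrable (fun x => starRingEnd ℂ (g x)) volume a b := by
    rw [intervalIntegrable_iff_integrableOn_Ioo_of_le hab.le]
    exact Complex.conjCLE.toContinuousLinearMap.integrable_comp (L2.integrable g)
  have key := integral_mul_primitive_add hgc (k.intervalIntegrable hab.le) (starRingEnd ℂ c) d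
  simp only [intervalIntegral.integral_same, add_zero, map_add]
  simp only [hconj] at key
  rw [← key, L2.inner_def, L2.inner_def, ← integral_add (L2.integrable_inner u k)
    (L2.integrable_inner g w), ← setIntegral_Ioo_eq hab.le]
  refine integral_congr_ae ?_
  filter_upwards [hc, hd] with x h1 h2
  rw [h1, h2, RCLike.inner_apply, RCLike.inner_apply, map_add]
  ring

end Primitive

/-! ### The chain operator is dissipative and onto -/

theorem L2.norm_sq_eq_integral {a b : ℝ} (f : L2 a b) :
    ‖f‖ ^ 2 = ∫ x in Ioo a b, ‖f x‖ ^ 2 := by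
  have h : ⟪f, f⟫_ℂ = ((∫ x in Ioo a b, ‖f x‖ ^ 2 : ℝ) : ℂ) := by
    rw [L2.inner_def, ← integral_complex_ofReal]
    refine integral_congr_ae (Eventually.of_forall fun x => ?_)
    simp only [Complex.ofReal_pow]
    exact inner_self_eq_norm_sq_to_K (f x)
  rw [← re_inner_self_eq, h, Complex.ofReal_re]

theorem HasValueAt.congr_point {a b x y : ℝ} {u : L2 a b} {c : ℂ} (h : HasValueAt u x c)
    (hxy : x = y) : HasValueAt u y c :=
  hxy ▸ h

/-! ### Structure of `V`: primitives along the chain, completeness, trace at `0`. -/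

variable {S : StringChain}

theorem natCast_lt_add_one (j : Fin S.N) : ((j : ℕ) : ℝ) < ((j : ℕ) : ℝ) + 1 := lt_add_one _

theorem natCast_eq_add_one {i j : Fin S.N} (h : (i : ℕ) + 1 = j) :
    ((j : ℕ) : ℝ) = ((i : ℕ) : ℝ) + 1 := by
  rw [← h, Nat.cast_add_one]

theorem natCast_first : (((S.first : Fin S.N) : ℕ) : ℝ) = 0 := Nat.cast_zero

theorem natCast_last : (S.N : ℝ) = (((S.last : Fin S.N) : ℕ) : ℝ) + 1 := by
  rw [← Nat.cast_add_one]
  congr 1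
  have := S.N_pos
  simp only [last]
  omega

/-- Integrate leftwards from the fixed end. The nodal values `c m`, minus the integral of `g` from
node `m` to `N`, satisfy `c N = 0`; string `j` runs from `c j` to `c (j + 1)`, so the pieces match.
The value at `0` is recorded because it exhibits the trace as a bounded functional of `∂ₓu`. -/
theorem V.exists_dx_eq (g : S.L2Prod) :
    ∃ u : S.V, (∀ j, u.dx j = g j) ∧ HasValueAt (u.toL2 S.first) 0
      (-∑ k : Fin S.N, ∫ y in ((k : ℕ) : ℝ)..((k : ℕ) : ℝ) + 1, g k y) := by
  set I : Fin S.N → ℂ := fun k => ∫ y in ((k : ℕ) : ℝ)..((k : ℕ) : ℝ) + 1, g k y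
  let c : ℕ → ℂ := fun m => -∑ k ∈ Finset.univ.filter fun k : Fin S.N => m ≤ (k : ℕ), I k
  have hc : ∀ j : Fin S.N, c j + I j = c (j + 1) := by
    intro j
    have h1 : (Finset.univ.filter fun k : Fin S.N => (j : ℕ) ≤ k)
        = insert j (Finset.univ.filter fun k : Fin S.N => (j : ℕ) + 1 ≤ k) := by
      ext k
      simp only [Finset.mem_filter, Finset.mem_univ, true_and, Finset.mem_insert, Fin.ext_iff]
      omega
    simp only [c]
    rw [h1, Finset.sum_insert (by simp)]
    ring
  have hcN : c S.N = 0 := by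
    simp only [c]
    rw [Finset.filter_false_of_mem fun k _ => not_le.2 k.2, Finset.sum_empty, neg_zero]
  choose w hw hwg using fun j : Fin S.N => L2.exists_primitive (natCast_lt_add_one j).le (g j) (c j)
  have hval : ∀ (j : Fin S.N) x, HasValueAt (w j) x (c j + ∫ y in ((j : ℕ) : ℝ)..x, g j y) :=
    fun j => L2.hasValueAt_of_ae_eq_primitive (natCast_lt_add_one j).le (hw j)
  have hleft : ∀ j : Fin S.N, HasValueAt (w j) ((j : ℕ) : ℝ) (c j) := fun j => by
    simpa using hval j ((j : ℕ) : ℝ)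
  have hright : ∀ j : Fin S.N, HasValueAt (w j) (((j : ℕ) : ℝ) + 1) (c (j + 1)) := fun j => by
    rw [← hc]
    exact hval j _
  have hmem : S.MemV (WithLp.toLp 2 w) := by
    refine ⟨fun j => ⟨g j, hwg j⟩, ?_, fun i j hij => ⟨c j, ?_, hleft j⟩⟩
    · have h1 := (hright S.last).congr_point natCast_last.symm
      rw [show ((S.last : Fin S.N) : ℕ) + 1 = S.N from
        Nat.sub_add_cancel S.N_pos, hcN] at h1
      exact h1
    · rw [natCast_eq_add_one hij, ← hij]
      exact hright i
  refine ⟨(⟨WithLp.toLp 2 w, hmem⟩ : S.submoduleV), fun j => (hwg j).weakDeriv_eq, ?_⟩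
  have h1 := (hleft S.first).congr_point natCast_first
  rw [show c ((S.first : Fin S.N) : ℕ) = -∑ k, I k by simp [c, first]] at h1
  exact h1

theorem V.ext_dx {u w : S.V} (h : ∀ j, u.dx j = w.dx j) : u = w := by
  refine sub_eq_zero.1 (V.eq_zero_of_dx_eq_zero _ fun j => ?_)
  rw [sub_eq_add_neg, ← neg_one_smul ℂ w, V.dx_add, V.dx_smul, h, neg_one_smul, add_neg_cancel]

theorem V.hasValueAt_zero (u : S.V) : HasValueAt (u.toL2 S.first) 0
    (-∑ k : Fin S.N, ∫ y in ((k : ℕ) : ℝ)..((k : ℕ) : ℝ) + 1, u.dx k y) := by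
  obtain ⟨w, hw, hw0⟩ := V.exists_dx_eq (WithLp.toLp 2 fun j => u.dx j)
  rw [V.ext_dx hw] at hw0
  exact hw0

theorem V.inner_eq (u w : S.V) : ⟪u, w⟫_ℂ = ∑ j, (S.ρ j : ℂ) * ⟪u.dx j, w.dx j⟫_ℂ := rfl

theorem V.norm_sq_eq (u : S.V) : ‖u‖ ^ 2 = ∑ j, S.ρ j * ‖u.dx j‖ ^ 2 := by
  rw [← re_inner_self_eq, V.inner_eq, Complex.re_sum]
  exact Finset.sum_congr rfl fun j _ => by rw [Complex.re_ofReal_mul, re_inner_self_eq]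

/-- The isometry `u ↦ (√ρ_j ∂ₓu_j)_j` of `V` onto `∏_j L²(j, j + 1)`. -/
def V.scaledDx : S.V →ₗᵢ[ℂ] S.L2Prod where
  toFun u := WithLp.toLp 2 fun j => ((√(S.ρ j) : ℝ) : ℂ) • u.dx j
  map_add' u w := by
    ext1 j
    simp only [V.dx_add, smul_add, PiLp.add_apply]
  map_smul' c u := by
    ext1 j
    simp only [V.dx_smul, PiLp.smul_apply, RingHom.id_apply]
    rw [smul_comm]
  norm_map' u := by
    rw [← sq_eq_sq₀ (norm_nonneg _) (norm_nonneg _), V.norm_sq_eq, PiLp.norm_sq_eq_of_L2]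
    refine Finset.sum_congr rfl fun j _ => ?_
    change ‖((√(S.ρ j) : ℝ) : ℂ) • u.dx j‖ ^ 2 = _
    rw [norm_smul, mul_pow, Complex.norm_real, Real.norm_eq_abs, sq_abs,
      Real.sq_sqrt (S.ρ_pos j).le]

theorem sqrt_rho_ne_zero (j : Fin S.N) : ((√(S.ρ j) : ℝ) : ℂ) ≠ 0 :=
  Complex.ofReal_ne_zero.2 (Real.sqrt_ne_zero'.2 (S.ρ_pos j))

theorem V.scaledDx_surjective : Function.Surjective (V.scaledDx (S := S)) := by
  intro g
  obtain ⟨u, hu, -⟩ := V.exists_dx_eq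
    (WithLp.toLp 2 fun j => ((√(S.ρ j) : ℝ) : ℂ)⁻¹ • g j : S.L2Prod)
  refine ⟨u, ?_⟩
  ext1 j
  change ((√(S.ρ j) : ℝ) : ℂ) • u.dx j = g j
  rw [hu]
  exact smul_inv_smul₀ (sqrt_rho_ne_zero j) (g j)

instance : CompleteSpace S.V :=
  (V.scaledDx.isometry.isUniformInducing.completeSpace_congr V.scaledDx_surjective).2 inferInstance

theorem V.exists_dxCLM (j : Fin S.N) :
    ∃ D : S.V →L[ℂ] L2 ((j : ℕ) : ℝ) (((j : ℕ) : ℝ) + 1), ∀ u, D u = u.dx j := by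
  refine ⟨((√(S.ρ j) : ℝ) : ℂ)⁻¹ •
    (PiLp.proj 2 (𝕜 := ℂ) (fun j : Fin S.N => L2 ((j : ℕ) : ℝ) (((j : ℕ) : ℝ) + 1)) j).comp
      V.scaledDx.toContinuousLinearMap, fun u => ?_⟩
  exact inv_smul_smul₀ (sqrt_rho_ne_zero j) (u.dx j)

/-- The trace `u ↦ u_0(0)` is a continuous linear functional on `V`. -/
theorem V.exists_trace : ∃ L : S.V →L[ℂ] ℂ, ∀ u, HasValueAt (u.toL2 S.first) 0 (L u) := by
  choose D hD using V.exists_dxCLM (S := S)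
  -- Pairing with the constant `1` in `L²(j, j + 1)` is integration over the string.
  refine ⟨-∑ j : Fin S.N, (innerSL ℂ (indicatorConstLp 2 MeasurableSet.univ (measure_ne_top
    (volume.restrict (Ioo ((j : ℕ) : ℝ) (((j : ℕ) : ℝ) + 1))) univ) (1 : ℂ))).comp (D j),
    fun u => ?_⟩
  convert u.hasValueAt_zero using 1
  rw [neg_apply, sum_apply]
  congr 1
  refine Finset.sum_congr rfl fun j _ => ?_
  rw [ContinuousLinearMap.comp_apply, hD, innerSL_apply_apply, L2.inner_indicatorConstLp_one,
    setIntegral_univ, setIntegral_Ioo_eq (natCast_lt_add_one j).le]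

/-! ### Energy identity and solvability for the chain operator. -/

theorem energy_eq (U : S.EnergySpace) : S.energy U = 1 / 2 * ‖U‖ ^ 2 := by
  rw [energy, WithLp.prod_norm_sq_eq_of_L2, V.norm_sq_eq, PiLp.norm_sq_eq_of_L2,
    ← Finset.sum_add_distrib]
  congr 1
  refine Finset.sum_congr rfl fun j _ => ?_
  have hi : ∀ f : L2 ((j : ℕ) : ℝ) (((j : ℕ) : ℝ) + 1), Integrable (fun x => ‖f x‖ ^ 2)
      (volume.restrict (Ioo ((j : ℕ) : ℝ) (((j : ℕ) : ℝ) + 1))) := fun f =>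
    (Lp.memLp f).integrable_norm_pow two_ne_zero
  rw [integral_add (hi _) ((hi _).const_mul _), integral_const_mul, ← L2.norm_sq_eq_integral,
    ← L2.norm_sq_eq_integral, add_comm]

/-- On string `j`, integration by parts leaves the end values of `ρ_j Re (conj v_j ∂ₓu_j)`.
Continuity of `v` and of the flux at the nodes makes them telescope; the damping condition turns the
term at `0` into `‖c‖²`. -/
theorem re_inner_operator (U : S.operator.domain) {c : ℂ}
    (hc : HasValueAt ((U : S.EnergySpace).snd S.first) 0 c) :
    (⟪S.operator U, (U : S.EnergySpace)⟫_ℂ).re = -‖c‖ ^ 2 := by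
  obtain ⟨U, hU⟩ := U
  have hmem : S.MemDomain U := hU
  have hlt := natCast_lt_add_one (S := S)
  choose va hva using fun j => (hmem.memV.memH1 j).exists_hasValueAt (hlt j) ((j : ℕ) : ℝ)
  choose vb hvb using fun j => (hmem.memV.memH1 j).exists_hasValueAt (hlt j) (((j : ℕ) : ℝ) + 1)
  choose wa hwa using fun j => (hmem.memH2 j).2.exists_hasValueAt (hlt j) ((j : ℕ) : ℝ)
  choose wb hwb using fun j => (hmem.memH2 j).2.exists_hasValueAt (hlt j) (((j : ℕ) : ℝ) + 1)
  have hL : ∀ j : Fin S.N, ((j : ℕ) : ℝ) ∈ Icc ((j : ℕ) : ℝ) (((j : ℕ) : ℝ) + 1) := fun j =>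
    left_mem_Icc.2 (hlt j).le
  have hR : ∀ j : Fin S.N, ((j : ℕ) : ℝ) + 1 ∈ Icc ((j : ℕ) : ℝ) (((j : ℕ) : ℝ) + 1) := fun j =>
    right_mem_Icc.2 (hlt j).le
  -- `P m` is the power through node `m`, read off on the string to its right. The default `P N = 0`
  -- is the correct value there, because `v_{N-1}(N) = 0`.
  let P : ℕ → ℝ := fun m => if h : m < S.N then
    S.ρ ⟨m, h⟩ * (starRingEnd ℂ (va ⟨m, h⟩) * wa ⟨m, h⟩).re else 0
  have hPa : ∀ j : Fin S.N, S.ρ j * (starRingEnd ℂ (va j) * wa j).re = P j := fun j => by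
    simp only [P, j.2, dif_pos]
  have hPb : ∀ j : Fin S.N, S.ρ j * (starRingEnd ℂ (vb j) * wb j).re = P (j + 1) := by
    intro i
    by_cases h : (i : ℕ) + 1 < S.N
    · let j : Fin S.N := ⟨i + 1, h⟩
      have hx : ((j : ℕ) : ℝ) = ((i : ℕ) : ℝ) + 1 := natCast_eq_add_one rfl
      obtain ⟨d, hd1, hd2⟩ := hmem.memV.node i j rfl
      obtain ⟨e, f, he, hf, hef⟩ := hmem.node i j rfl
      have h1 := (hvb i).unique (hlt i) (hR i) (hd1.congr_point hx)
      have h2 := (hva j).unique (hlt j) (hL j) hd2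
      have h3 := (hwb i).unique (hlt i) (hR i) (he.congr_point hx)
      have h4 := (hwa j).unique (hlt j) (hL j) hf
      change _ = P (j : ℕ)
      rw [← hPa j, ← Complex.re_ofReal_mul, ← Complex.re_ofReal_mul, h1, h2, h3, h4]
      congr 1
      linear_combination (starRingEnd ℂ d) * hef
    · have hi : i = S.last := Fin.ext (by
        have := i.2
        simp only [last]
        omega)
      subst hi
      have h1 := (hvb S.last).unique (hlt S.last) (hR _) 
        (hmem.memV.right_end.congr_point natCast_last)
      simp only [P, dif_neg h, h1, map_zero, zero_mul, Complex.zero_re, mul_zero]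
  have hsum : (⟪S.operator ⟨U, hU⟩, U⟫_ℂ).re = ∑ j : Fin S.N, (P (j + 1) - P j) := by
    rw [WithLp.prod_inner_apply, V.inner_eq, PiLp.inner_apply, ← Finset.sum_add_distrib,
      Complex.re_sum]
    refine Finset.sum_congr rfl fun j _ => ?_
    have key := (hmem.memV.memH1 j).hasWeakDeriv.inner_add_inner (hlt j)
      (hmem.memH2 j).2.hasWeakDeriv (hva j) (hvb j) (hwa j) (hwb j)
    have key' := congrArg Complex.re key
    rw [← hPa, ← hPb, ← mul_sub, ← Complex.sub_re, ← key']
    change ((S.ρ j : ℂ) * ⟪weakDeriv (U.snd j), weakDeriv (U.fst.toL2 j)⟫_ℂ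
      + ⟪(S.ρ j : ℂ) • weakDeriv (weakDeriv (U.fst.toL2 j)), U.snd j⟫_ℂ).re = _
    rw [inner_smul_left, Complex.conj_ofReal, Complex.add_re, Complex.re_ofReal_mul,
      Complex.re_ofReal_mul, Complex.add_re,
      ← inner_conj_symm (weakDeriv (weakDeriv (U.fst.toL2 j))) (U.snd j), Complex.conj_re]
    ring
  have hP0 : P 0 = ‖c‖ ^ 2 := by
    obtain ⟨d, hd1, hd2⟩ := hmem.damping
    have h0 : HasValueAt (U.snd S.first) 0 (va S.first) := (hva S.first).congr_point natCast_first
    have h0' : HasValueAt (U.fst.dx S.first) 0 (wa S.first) :=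
      (hwa S.first).congr_point natCast_first
    have hz : (0 : ℝ) ∈ Icc (((S.first : Fin S.N) : ℕ) : ℝ)
        ((((S.first : Fin S.N) : ℕ) : ℝ) + 1) := by
      rw [natCast_first]
      exact ⟨le_rfl, by norm_num⟩
    have h1 := hc.unique (hlt _) hz h0
    have h2 := hd2.unique (hlt _) hz h0
    have h3 := hd1.unique (hlt _) hz h0'
    have h4 := hPa S.first
    change _ = P 0 at h4
    rw [← h4, ← Complex.re_ofReal_mul, mul_left_comm, ← h3, h2, h1,
      ← Complex.normSq_eq_conj_mul_self, Complex.ofReal_re, Complex.normSq_eq_norm_sq]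
  have hPN : P S.N = 0 := by simp only [P, lt_irrefl, dif_neg, not_false_eq_true]
  change (⟪S.operator ⟨U, hU⟩, U⟫_ℂ).re = _
  rw [hsum, Fin.sum_univ_eq_sum_range (fun m => P (m + 1) - P m), Finset.sum_range_sub, hPN, hP0,
    zero_sub]

theorem exists_operator_eq (F : S.EnergySpace) : ∃ U : S.operator.domain, S.operator U = F := by
  set h : S.L2Prod := F.snd
  set I : Fin S.N → ℂ := fun k => ∫ y in ((k : ℕ) : ℝ)..((k : ℕ) : ℝ) + 1, h k y
  obtain ⟨f₀, hf₀⟩ : ∃ c, HasValueAt (F.fst.toL2 S.first) 0 c := ⟨_, F.fst.hasValueAt_zero⟩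
  -- Nodal values of the flux `ρ ∂ₓu`: it starts from `v_0(0) = f₀` and grows by the integral of `h`
  -- over each string crossed.
  let c : ℕ → ℂ := fun m => f₀ + ∑ k ∈ Finset.univ.filter fun k : Fin S.N => (k : ℕ) < m, I k
  have hc : ∀ j : Fin S.N, c j + I j = c (j + 1) := by
    intro j
    have h1 : (Finset.univ.filter fun k : Fin S.N => (k : ℕ) < j + 1)
        = insert j (Finset.univ.filter fun k : Fin S.N => (k : ℕ) < j) := by
      ext k
      simp only [Finset.mem_filter, Finset.mem_univ, true_and, Finset.mem_insert, Fin.ext_iff]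
      omega
    simp only [c]
    rw [h1, Finset.sum_insert (by simp)]
    ring
  choose w hw hwg using fun j : Fin S.N => L2.exists_primitive (natCast_lt_add_one j).le (h j) (c j)
  have hval : ∀ (j : Fin S.N) x, HasValueAt (w j) x (c j + ∫ y in ((j : ℕ) : ℝ)..x, h j y) :=
    fun j => L2.hasValueAt_of_ae_eq_primitive (natCast_lt_add_one j).le (hw j)
  have hleft : ∀ j : Fin S.N, HasValueAt (w j) ((j : ℕ) : ℝ) (c j) := fun j => by
    simpa using hval j ((j : ℕ) : ℝ)
  have hright : ∀ j : Fin S.N, HasValueAt (w j) (((j : ℕ) : ℝ) + 1) (c (j + 1)) := fun j => by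
    rw [← hc]
    exact hval j _
  have hρ : ∀ j, (S.ρ j : ℂ) ≠ 0 := fun j => Complex.ofReal_ne_zero.2 (S.ρ_pos j).ne'
  obtain ⟨u, hu', -⟩ := V.exists_dx_eq (WithLp.toLp 2 fun j => (S.ρ j : ℂ)⁻¹ • w j : S.L2Prod)
  have hu : ∀ j, u.dx j = (S.ρ j : ℂ)⁻¹ • w j := hu'
  have hwd : ∀ j, HasWeakDeriv (u.dx j) ((S.ρ j : ℂ)⁻¹ • h j) := fun j => by
    rw [hu]
    exact (hwg j).smul _
  let U : S.EnergySpace := WithLp.toLp 2 (u, F.fst.toL2)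
  have hU : S.MemDomain U := by
    refine ⟨fun j => ⟨u.memV.memH1 j, ⟨_, hwd j⟩⟩, F.fst.memV, ⟨(S.ρ S.first : ℂ)⁻¹ * c 0, ?_, ?_⟩,
      fun i j hij => ⟨(S.ρ i : ℂ)⁻¹ * c j, (S.ρ j : ℂ)⁻¹ * c j, ?_, ?_, ?_⟩⟩
    · change HasValueAt (u.dx S.first) 0 _
      rw [hu]
      exact ((hleft S.first).congr_point natCast_first).smul _
    · rw [mul_inv_cancel_left₀ (hρ _)]
      change HasValueAt (F.fst.toL2 S.first) 0 _
      simpa [c] using hf₀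
    · change HasValueAt (u.dx i) _ _
      rw [hu, natCast_eq_add_one hij, ← hij]
      exact (hright i).smul _
    · change HasValueAt (u.dx j) _ _
      rw [hu]
      exact (hleft j).smul _
    · rw [neg_mul, mul_inv_cancel_left₀ (hρ _), mul_inv_cancel_left₀ (hρ _), neg_add_cancel]
  refine ⟨⟨U, hU⟩, ?_⟩
  refine WithLp.ofLp_injective 2 (Prod.ext ?_ ?_)
  · exact Subtype.ext rfl
  · refine PiLp.ext fun j => ?_
    change (S.ρ j : ℂ) • weakDeriv (u.dx j) = h j
    rw [(hwd j).weakDeriv_eq, smul_inv_smul₀ (hρ j)]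

theorem isOntoDissipative_operator : IsOntoDissipative S.operator where
  re_inner_nonpos U := by
    have hU : S.MemDomain U := U.2
    obtain ⟨c, -, hc⟩ := hU.damping
    rw [re_inner_operator U hc]
    exact neg_nonpos.2 (sq_nonneg _)
  exists_eq := exists_operator_eq

/-! ### The dissipation law -/

variable {S : StringChain}

/-- The continuous trace `M` commutes with the time derivative, and the first component of `𝓐 U` is
`v`; so the derivative of `u_0(t, 0)` is the trace of `v`. -/
theorem IsClassicalSolution.exists_dissipation {U₀ : S.EnergySpace} {U : ℝ → S.EnergySpace}
    (hU : IsClassicalSolution S.operator U₀ U) :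
    ∃ y y' : ℝ → ℂ, ∀ t, 0 ≤ t →
      HasValueAt ((U t).fst.toL2 S.first) 0 (y t) ∧
      HasDerivWithinAt y (y' t) (Ici 0) t ∧
      HasValueAt ((U t).snd S.first) 0 (y' t) ∧
      HasDerivWithinAt (fun s => S.energy (U s)) (-‖y' t‖ ^ 2) (Ici 0) t := by
  obtain ⟨L, hL⟩ := V.exists_trace (S := S)
  let M : S.EnergySpace →L[ℂ] ℂ := L.comp (WithLp.fstL 2 ℂ S.V S.L2Prod)
  have hM : ∀ W : S.EnergySpace, HasValueAt (W.fst.toL2 S.first) 0 (M W) := fun W => hL W.fst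
  -- The time derivative is chosen as a function on all of `ℝ`, with the irrelevant value `0` at
  -- negative times.
  have hex : ∀ t, ∃ W : S.EnergySpace, 0 ≤ t → ∃ h : U t ∈ S.operator.domain,
      W = S.operator ⟨U t, h⟩ ∧ HasDerivWithinAt U W (Ici 0) t := by
    intro t
    by_cases ht : 0 ≤ t
    · obtain ⟨h, hd⟩ := hU.equation t ht
      exact ⟨_, fun _ => ⟨h, rfl, hd⟩⟩
    · exact ⟨0, fun h => absurd h ht⟩
  choose W hW using hex
  refine ⟨fun t => M (U t), fun t => M (W t), fun t ht => ?_⟩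
  obtain ⟨h, hWt, hd⟩ := hW t ht
  have hv : HasValueAt ((U t).snd S.first) 0 (M (W t)) := by
    have h1 := hM (W t)
    rw [hWt] at h1 ⊢
    exact h1
  refine ⟨hM _, (M.restrictScalars ℝ).hasFDerivAt.comp_hasDerivWithinAt t hd, hv, ?_⟩
  simp_rw [energy_eq]
  refine ((hasDerivWithinAt_norm_sq hd).const_mul (1 / 2)).congr_deriv ?_
  rw [← re_inner_operator ⟨U t, h⟩ hv, hWt]
  ring

end StringChain

end

theorem proposition2p1 (S : StringChain) :
    -- `𝓗` is a Hilbert space and `𝓐` generates a contraction semigroup on it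
    CompleteSpace S.EnergySpace ∧
    (∃ T : ℝ → S.EnergySpace →L[ℂ] S.EnergySpace,
      StringChain.IsContractionSemigroup T ∧ StringChain.IsGenerator S.operator T) ∧
    -- existence and uniqueness of the solution in `C([0, ∞), 𝓗)`
    (∀ U₀ : S.EnergySpace,
      ∃ U : ℝ → S.EnergySpace, StringChain.IsMildSolution S.operator U₀ U ∧
        ∀ W : ℝ → S.EnergySpace, StringChain.IsMildSolution S.operator U₀ W →
          EqOn W U (Ici 0)) ∧
    -- regularity of the solution for data in the domain
    (∀ U₀ ∈ S.operator.domain, ∀ U : ℝ → S.EnergySpace,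
      StringChain.IsMildSolution S.operator U₀ U →
        StringChain.IsClassicalSolution S.operator U₀ U) ∧
    -- dissipation law, with `y t = u_0(t, 0)` and `y' t = ∂ₜu_0(t, 0)`
    (∀ (U₀ : S.EnergySpace) (U : ℝ → S.EnergySpace),
      StringChain.IsClassicalSolution S.operator U₀ U →
        (∃ y y' : ℝ → ℂ, ∀ t, 0 ≤ t →
          StringChain.HasValueAt ((U t).fst.toL2 S.first) 0 (y t) ∧
          HasDerivWithinAt y (y' t) (Ici 0) t ∧
          StringChain.HasValueAt ((U t).snd S.first) 0 (y' t) ∧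
          HasDerivWithinAt (fun s => S.energy (U s)) (-‖y' t‖ ^ 2) (Ici 0) t) ∧
        AntitoneOn (fun t => S.energy (U t)) (Ici 0)) := by
  have hA := StringChain.isOntoDissipative_operator (S := S)
  obtain ⟨T, hT⟩ := hA.exists_semigroup
  refine ⟨inferInstance, ⟨T, hT.isContractionSemigroup, hT.isGenerator hA⟩,
    fun U₀ => ⟨_, hT.isMildSolution hA U₀, fun W hW => (hT.isMildSolution hA U₀).eqOn hA hW⟩,
    fun U₀ hU₀ U hU => hU.isClassicalSolution hA hU₀,
    fun U₀ U hU => ⟨hU.exists_dissipation, ?_⟩⟩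
  obtain ⟨y, y', h⟩ := hU.exists_dissipation
  refine antitoneOn_of_hasDerivWithinAt_nonpos (convex_Ici 0)
    (fun t ht => (h t ht).2.2.2.continuousWithinAt)
    (fun t ht => (h t (interior_subset ht)).2.2.2.mono interior_subset) fun t _ => ?_
  exact neg_nonpos.2 (sq_nonneg _)
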